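/- **Setting.** Let $\mathfrak L$ be a finite set. For a finitely supported multi-index $\beta:\mathfrak L\times\mathbb N_0\to\mathbb N_0$ put $|\beta|=\sum_{(\mathfrak l,k)}\beta(\mathfrak l,k)$ (length) and $[\beta]=\sum_{(\mathfrak l,k)}(1-k)\beta(\mathfrak l,k)$, and let $\mathcal T=\{\beta : [\beta]=1\}$. In $\mathbb R[z_{(\mathfrak l,k)}]_{(\mathfrak l,k)\in\mathfrak L\times\mathbb N_0}$ let $T=\mathrm{span}\{z^\beta:\beta\in\mathcal T\}$, let $T^*=\mathbb R^{\mathcal T}$ be the space of formal series $\sum_{\beta\in\mathcal T}\pi_\beta z^\beta$, and let $D=\sum_{(\mathfrak l,k)}(k+1)z_{(\mathfrak l,k+1)}\partial_{(\mathfrak l,k)}$, where $\partial_{(\mathfrak l,k)}=\partial_{z_{(\mathfrak l,k)}}$. $T$ is a pre-Lie algebra under $(\pi,\pi')\mapsto \pi D\pi'$. Let $R$ be the space with basis $\{r^{(\gamma,\mathfrak l)}:\gamma\in\mathcal T,\mathfrak l\in\mathfrak L\}$ and pre-Lie product $$r^{(\gamma,\mathfrak l)}\triangleright r^{(\gamma',\mathfrak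 l')}=\sum_{\beta}\Big(\sum_{k}\big(\tfrac1{k!}D^kz^\gamma\big)\partial_{(\mathfrak l,k)}\Big)_{\beta}^{\gamma'}r^{(\beta,\mathfrak l')}.$$ For a pre-Lie algebra $(L,\triangleright)$ with basis $(a_i)_{i}$ let $U(L)$ be the universal enveloping algebra of its commutator Lie algebra. For $u\in U(L)$ and $a\in L$ define $u\odot a$ by $1\odot a=a$ and $(bu)\odot a=b(u\odot a)-u\odot(b\triangleright a)$ for $b\in L$; for a multi-index $I=e_{i_1}+\dots+e_{i_n}$ let $A_I=\frac1{I!}\,((1\odot a_{i_1})\odot\cdots)\odot a_{i_n}$. Given an algebra morphism $\psi:U(L)\to\mathrm{End}(V)$, where $V$ has basis $(v_j)$, let $(\psi(A_I))_j^{j'}$ denote the $v_j$-coefficient of $\psi(A_I)v_{j'}$; a series $f=(f_i)_i$ acts on series $g=(g_j)_j$ by $$(\psi(\exp f)\,g)_j=\sum_{I,j'} f^I(\psi(A_I))_j^{j'}\,g_{j'},\qquad f^I=\prod_i f_i^{I(i)}.$$ Let $\rho_D:U(T)\to\mathrm{End}(T)$ be the algebra morphism extending $\pi\mapsto(\pi'\mapsto\pi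 D\pi')$, and let $\tilde\rho:U(R)\to\mathrm{End}(T)$ be the one extending $r^{(\gamma,\mathfrak l)}\mapsto\sum_k(\frac1{k!}D^kz^\gamma)\partial_{(\mathfrak l,k)}$. For $\mathbf c\in R$ write $T_{\mathbf c}=\tilde\rho(\exp\mathbf c)$, acting on $T^*$. For $\alpha\in(0,1)$, an *$\alpha$-rough path* is a map $\mathbf X:[0,1]^2\to T^*$ such that, for all $0\le s<u<t\le1$, Chen's relation $$\mathbf X_{st}=\mathbf X_{su}+\rho_D(\exp\mathbf X_{su})\,\mathbf X_{ut}$$ holds and such that $\sup_{0\le s<t\le1}|\mathbf X_{st\,\beta}|/|t-s|^{\alpha|\beta|}<\infty$ for every $\beta\in\mathcal T$. For $N\ge1$ let $$R_{\ge2}^{(N)}=\mathrm{span}\{r^{(\gamma,\mathfrak l)}:2\le|\gamma|\le N\},$$ and for $\emptyset\ne\mathfrak L'\subset\mathfrak L$ let $$R_{\mathfrak L'}^{(N)}=\mathrm{span}\Big\{r^{(\gamma,\mathfrak l)}:\mathfrak l\in\mathfrak L',\ \sum_{\mathfrak m\notin\mathfrak L',\,k}\gamma(\mathfrak m,k)>0,\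 |\gamma|\le N\Big\}.$$ **Theorem.** Let $\mathbf X:[0,1]^2\to T^*$ be an $\alpha$-rough path with $\alpha\in(0,1)$, and let $N\ge1$ be an integer. (i) If $\mathbf c\in R_{\ge2}^{(N)}$, then $T_{\mathbf c}\mathbf X$ is an $\alpha/N$-rough path. (ii) If $\emptyset\ne\mathfrak L'\subset\mathfrak L$ and $\mathbf c\in R_{\mathfrak L'}^{(N)}$, then $T_{\mathbf c}\mathbf X$ is an $\alpha/N$-rough path. (iii) Let $\mathbf c\in R_{\mathfrak L'}^{(N)}$ with $\emptyset\ne\mathfrak L'\subset\mathfrak L$. Assume in addition that for every $\mathfrak l\in\mathfrak L'$ there is $\alpha_{\mathfrak l}\ge\alpha$ such that for every $\beta\in\mathcal T$ $$\sup_{0\le s<t\le1}\frac{|\mathbf X_{st\,\beta}|}{|t-s|^{|\beta|_{\mathfrak L'}}}<\infty,\qquad |\beta|_{\mathfrak L'}=\sum_{\mathfrak l\in\mathfrak L'}\alpha_{\mathfrak l}\sum_k\beta(\mathfrak l,k)+\alpha\sum_{\mathfrak l\notin\mathfrak L'}\sum_k\beta(\mathfrak l,k).$$ Then $T_{\mathbf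 c}\mathbf X$ is a $\min(\alpha,\alpha_{\min}/N)$-rough path, where $\alpha_{\min}=\min_{\mathfrak l\in\mathfrak L'}\alpha_{\mathfrak l}$. Moreover the sums defining these objects are finite: for every $\beta\in\mathcal T$ only finitely many pairs $(I,\gamma)$ satisfy $(\rho_D(A_I))_\beta^\gamma\ne0$; and, with $A_I$ now the elements built on the basis of $R$, only finitely many pairs $(I,\gamma)$ satisfy $(\tilde\rho(A_I))_\beta^\gamma\ne0$ with $I$ supported in $\{(\gamma',\mathfrak l'):|\gamma'|\ge2\}$, respectively in $\{(\gamma',\mathfrak l'):\mathfrak l'\in\mathfrak L',\ \sum_{\mathfrak m\notin\mathfrak L',\,k}\gamma'(\mathfrak m,k)>0\}$. -/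

import Mathlib

noncomputable section

/-! ### Guin–Oudom procedure for a pre-Lie algebra -/

namespace PreLie

section GuinOudom

variable {L : Type*} [LeftPreLieRing L] [LeftPreLieAlgebra ℝ L]

attribute [local instance 100] LieRing.ofAssociativeRing

/-- The canonical action of a pre-Lie algebra on itself, `a ↦ (b ↦ a ▷ b)`, as a Lie algebra
morphism into endomorphisms with the commutator bracket. -/
def rhoLie : L →ₗ⁅ℝ⁆ Module.End ℝ L where
  toLinearMap := LinearMap.mul ℝ L
  map_lie' := by
    intro x y
    ext z
    have h := LeftPreLieRing.assoc_symm x y z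
    simp only [associator_apply] at h
    simp only [Ring.lie_def, AddHom.toFun_eq_coe,
      LinearMap.coe_toAddHom, LinearMap.mul_apply', LinearMap.sub_apply, Module.End.mul_apply,
      sub_mul]
    rw [← sub_eq_zero] at h ⊢
    rw [← h]
    abel

variable (L) in
/-- The universal enveloping algebra of the Lie algebra `(L, [·,·]_▷)`. -/
abbrev U : Type _ := UniversalEnvelopingAlgebra ℝ L

/-- The extension of the canonical action to an algebra morphism on the enveloping algebra. -/
def rho : U L →ₐ[ℝ] Module.End ℝ L := UniversalEnvelopingAlgebra.lift ℝ rhoLie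

/-- The Lie algebra action of `L` on linear maps `φ : L → U L` given by
`(b • φ) a = b (φ a) - φ (b ▷ a)`. -/
def goActLie : L →ₗ⁅ℝ⁆ Module.End ℝ (L →ₗ[ℝ] U L) where
  toFun b :=
    { toFun := fun φ =>
        LinearMap.mulLeft ℝ (UniversalEnvelopingAlgebra.ι ℝ b) ∘ₗ φ - φ ∘ₗ rhoLie b
      map_add' := by
        intro φ ψ
        ext a
        simp only [LinearMap.sub_apply, LinearMap.comp_apply, LinearMap.add_apply, map_add]
        abel
      map_smul' := by
        intro r φ
        ext a
        simp only [LinearMap.sub_apply, LinearMap.comp_apply, LinearMap.smul_apply, map_smul,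
          RingHom.id_apply, smul_sub] }
  map_add' := by
    intro b c
    ext φ a
    simp only [LinearMap.coe_mk, AddHom.coe_mk, LinearMap.sub_apply, LinearMap.comp_apply,
      LinearMap.add_apply, map_add, LinearMap.mulLeft_apply, add_mul]
    abel
  map_smul' := by
    intro r b
    ext φ a
    simp only [LinearMap.coe_mk, AddHom.coe_mk, LinearMap.sub_apply, LinearMap.comp_apply,
      LinearMap.smul_apply, map_smul, RingHom.id_apply, smul_sub, LinearMap.mulLeft_apply,
      smul_mul_assoc]
  map_lie' := by
    intro b c
    ext φ a
    simp only [LinearMap.coe_mk, AddHom.coe_mk, LinearMap.sub_apply, LinearMap.comp_apply,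
      LinearMap.mulLeft_apply, LieHom.map_lie, LieRing.of_associative_ring_bracket,
      Module.End.mul_apply, sub_mul, map_sub, mul_assoc]
    abel

/-- The product `U ⊙ a` of `U ∈ U(L)` with `a ∈ L`, determined by `1 ⊙ a = a` and
`(b U) ⊙ a = b (U ⊙ a) - U ⊙ (b ▷ a)` for `b ∈ L`. -/
def goProd (u : U L) (a : L) : U L :=
  UniversalEnvelopingAlgebra.lift ℝ goActLie u
    (UniversalEnvelopingAlgebra.ι ℝ : L →ₗ⁅ℝ⁆ U L).toLinearMap a

theorem goProd_one (a : L) : goProd (1 : U L) a = UniversalEnvelopingAlgebra.ι ℝ a := by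
  simp only [goProd, map_one, Module.End.one_apply]
  rfl

theorem goProd_ι_mul (b a : L) (u : U L) :
    goProd (UniversalEnvelopingAlgebra.ι ℝ b * u) a =
      UniversalEnvelopingAlgebra.ι ℝ b * goProd u a - goProd u (b * a) := by
  simp only [goProd, map_mul, UniversalEnvelopingAlgebra.lift_ι_apply, Module.End.mul_apply]
  rfl

theorem goProd_add (u v : U L) (a : L) : goProd (u + v) a = goProd u a + goProd v a := by
  simp only [goProd, map_add, LinearMap.add_apply]

theorem goProd_smul (r : ℝ) (u : U L) (a : L) : goProd (r • u) a = r • goProd u a := by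
  simp only [goProd, map_smul, LinearMap.smul_apply]

theorem goProd_sub (u v : U L) (a : L) : goProd (u - v) a = goProd u a - goProd v a := by
  simp only [goProd, map_sub, LinearMap.sub_apply]

theorem goProd_right_sub (u : U L) (a b : L) :
    goProd u (a - b) = goProd u a - goProd u b := by
  simp only [goProd, map_sub]

/-- An induction principle for the enveloping algebra: it is spanned by iterated left
multiplications of the unit by elements of `L`. -/
theorem U_induction {P : U L → Prop} (one : P 1)
    (mul : ∀ (b : L) (u : U L), P u → P (UniversalEnvelopingAlgebra.ι ℝ b * u))
    (add : ∀ u v : U L, P u → P v → P (u + v)) (smul : ∀ (r : ℝ) (u : U L), P u → P (r • u))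
    (u : U L) : P u := by
  have key : ∀ (x : TensorAlgebra ℝ L) (v : U L), P v →
      P (UniversalEnvelopingAlgebra.mkAlgHom ℝ L x * v) := by
    intro x
    induction x using TensorAlgebra.induction with
    | algebraMap r =>
      intro v hv
      rw [AlgHom.commutes, ← Algebra.smul_def]
      exact smul r v hv
    | ι b => exact fun v hv => mul b v hv
    | mul x y hx hy =>
      intro v hv
      rw [map_mul, mul_assoc]
      exact hx _ (hy _ hv)
    | add x y hx hy =>
      intro v hv
      rw [map_add, add_mul]
      exact add _ _ (hx _ hv) (hy _ hv)
  obtain ⟨x, rfl⟩ : ∃ x, UniversalEnvelopingAlgebra.mkAlgHom ℝ L x = u :=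
    RingCon.mkₐ_surjective _ u
  simpa using key x 1 one

theorem goProd_comm (u : U L) (a b : L) :
    goProd (goProd u a) b = goProd (goProd u b) a := by
  revert a b
  refine U_induction (P := fun u => ∀ a b : L, goProd (goProd u a) b = goProd (goProd u b) a)
    ?_ ?_ ?_ ?_ u
  · intro a b
    have h : ∀ x y : L, goProd (goProd (1 : U L) x) y =
        UniversalEnvelopingAlgebra.ι ℝ x * UniversalEnvelopingAlgebra.ι ℝ y -
          UniversalEnvelopingAlgebra.ι ℝ (x * y) := by
      intro x y
      rw [goProd_one, ← mul_one (UniversalEnvelopingAlgebra.ι ℝ x), goProd_ι_mul, goProd_one,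
        goProd_one, mul_one]
    have hl : UniversalEnvelopingAlgebra.ι ℝ (a * b) - UniversalEnvelopingAlgebra.ι ℝ (b * a) =
        UniversalEnvelopingAlgebra.ι ℝ a * UniversalEnvelopingAlgebra.ι ℝ b -
          UniversalEnvelopingAlgebra.ι ℝ b * UniversalEnvelopingAlgebra.ι ℝ a := by
      rw [← LieRing.of_associative_ring_bracket, ← LieHom.map_lie, ← map_sub]
      rfl
    rw [h, h, ← sub_eq_zero]
    rw [← sub_eq_zero] at hl
    rw [← neg_eq_zero, ← hl]
    abel
  · intro c u hu a b
    simp only [goProd_ι_mul, goProd_sub]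
    rw [hu a b, hu (c * a) b, hu a (c * b)]
    abel
  · intro u v hu hv a b
    simp only [goProd_add, hu a b, hv a b]
  · intro r u hu a b
    simp only [goProd_smul, hu a b]

instance : RightCommutative (goProd (L := L)) := ⟨goProd_comm⟩

/-- The Guin–Oudom element `A_I = (1 / I!) a_{i_1} ⊙ ⋯ ⊙ a_{i_n}` for a multi-index
`I = e_{i_1} + ⋯ + e_{i_n}` over the index set of a family `a` in `L`. -/
def goBasis {ι : Type*} (a : ι → L) (I : ι →₀ ℕ) : U L :=
  ((I.prod fun _ n => (n.factorial : ℝ))⁻¹) • Multiset.foldl goProd 1 (I.toMultiset.map a)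

/-- Characters of the free commutative algebra over the index set of a basis of `L`. -/
abbrev Character (ι : Type*) : Type _ := MvPolynomial ι ℝ →ₐ[ℝ] ℝ

/-- The exponential of a Lie series `f ∈ L^*` (given by its coordinates): its multiplicative
extension to the free commutative algebra over the basis. -/
def goExp {ι : Type*} (f : ι → ℝ) : Character ι := MvPolynomial.aeval f

/-- The structure constant `(ψ(A_I))_j^{j'}` of an action `ψ` of `U L` on a space `V` with basis
`v`, where `(A_I)` is the Guin–Oudom basis over `a`. -/
def structConst {ι κ V : Type*} [AddCommGroup V] [Module ℝ V] (ψ : U L →ₐ[ℝ] Module.End ℝ V)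
    (a : Module.Basis ι ℝ L) (v : Module.Basis κ ℝ V) (I : ι →₀ ℕ) (j j' : κ) : ℝ :=
  v.repr (ψ (goBasis a I) (v j')) j

/-- The finiteness property: for every `j`, only finitely many pairs of an index `j'` and a
multi-index `I` supported in `S` have a non-zero structure constant `(ψ(A_I))_j^{j'}`. -/
def FinitenessProperty {ι κ V : Type*} [AddCommGroup V] [Module ℝ V]
    (ψ : U L →ₐ[ℝ] Module.End ℝ V) (a : Module.Basis ι ℝ L) (v : Module.Basis κ ℝ V)
    (S : Set ι) : Prop :=
  ∀ j : κ, {p : (ι →₀ ℕ) × κ |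
    (p.1.support : Set ι) ⊆ S ∧ structConst ψ a v p.1 j p.2 ≠ 0}.Finite

/-- The action `ψ(F)` of a character `F = ∑_I F^I A_I` on formal series `g = ∑_j g_j v_j`, that
is `(ψ(F) g)_j = ∑_{I, j'} F^I (ψ(A_I))_j^{j'} g_{j'}`, where `F^I` is the value of `F` at the
monomial with exponent `I`. -/
def charAct {ι κ V : Type*} [AddCommGroup V] [Module ℝ V] (ψ : U L →ₐ[ℝ] Module.End ℝ V)
    (a : Module.Basis ι ℝ L) (v : Module.Basis κ ℝ V) (F : Character ι) (g : κ → ℝ) : κ → ℝ :=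
  fun j => ∑ᶠ p : (ι →₀ ℕ) × κ,
    F (MvPolynomial.monomial p.1 1) * structConst ψ a v p.1 j p.2 * g p.2

end GuinOudom

end PreLie

/-! ### Multi-indices over `𝔏 × ℕ` and the pre-Lie algebra `(T, D)` -/

namespace MultiIndex

section Defs

variable (𝔏 : Type*)

/-- The weight of the variable `z_{(l,k)}`. -/
def wt (p : 𝔏 × ℕ) : ℤ := 1 - (p.2 : ℤ)

variable {𝔏}

/-- `[β] = ∑_{(l,k)} (1 - k) β(l,k)`. -/
def bracket (β : 𝔏 × ℕ →₀ ℕ) : ℤ := Finsupp.weight (wt 𝔏) β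

variable (𝔏) in
/-- The populated multi-indices, `[β] = 1`. -/
def populated : Set (𝔏 × ℕ →₀ ℕ) := {β | bracket β = 1}

/-- The length of a multi-index. -/
def length (β : 𝔏 × ℕ →₀ ℕ) : ℕ := β.sum fun _ n => n

variable (𝔏) in
/-- The derivation `D = ∑_{(l,k)} (k+1) z_{(l,k+1)} ∂_{z_{(l,k)}}`. -/
def D : Derivation ℝ (MvPolynomial (𝔏 × ℕ) ℝ) (MvPolynomial (𝔏 × ℕ) ℝ) :=
  MvPolynomial.mkDerivation ℝ fun p => ((p.2 + 1 : ℕ) : ℝ) • MvPolynomial.X (p.1, p.2 + 1)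

variable (𝔏) in
/-- The space `T` spanned by the monomials `z^β` with `β` populated. -/
def T : Type _ := MvPolynomial.restrictSupport ℝ (populated 𝔏)

instance : AddCommGroup (T 𝔏) :=
  inferInstanceAs (AddCommGroup (MvPolynomial.restrictSupport ℝ (populated 𝔏)))

instance : Module ℝ (T 𝔏) :=
  inferInstanceAs (Module ℝ (MvPolynomial.restrictSupport ℝ (populated 𝔏)))

variable (𝔏) in
/-- The inclusion of `T` in the polynomial algebra. -/
def T.incl : T 𝔏 →ₗ[ℝ] MvPolynomial (𝔏 × ℕ) ℝ :=
  (MvPolynomial.restrictSupport ℝ (populated 𝔏)).subtype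

theorem T.incl_injective : Function.Injective (T.incl 𝔏) := Subtype.val_injective

variable (𝔏) in
/-- The monomial basis `(z^β)` of `T`, indexed by populated multi-indices. -/
def tBasis : Module.Basis (populated 𝔏) ℝ (T 𝔏) :=
  MvPolynomial.basisRestrictSupport ℝ (populated 𝔏)

theorem mem_T_iff (φ : MvPolynomial (𝔏 × ℕ) ℝ) :
    φ ∈ MvPolynomial.restrictSupport ℝ (populated 𝔏) ↔
      MvPolynomial.IsWeightedHomogeneous (wt 𝔏) φ 1 := by
  rw [MvPolynomial.mem_restrictSupport_iff]
  simp only [Set.subset_def, Finset.mem_coe, MvPolynomial.mem_support_iff,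
    MvPolynomial.IsWeightedHomogeneous]
  rfl

theorem T.isWeightedHomogeneous (x : T 𝔏) :
    MvPolynomial.IsWeightedHomogeneous (wt 𝔏) (T.incl 𝔏 x) 1 :=
  (mem_T_iff _).1 x.2

/-- Elements of `T` from weighted homogeneous polynomials. -/
def T.mk (φ : MvPolynomial (𝔏 × ℕ) ℝ)
    (h : MvPolynomial.IsWeightedHomogeneous (wt 𝔏) φ 1) : T 𝔏 :=
  ⟨φ, (mem_T_iff _).2 h⟩

@[simp] theorem T.incl_mk (φ : MvPolynomial (𝔏 × ℕ) ℝ)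
    (h : MvPolynomial.IsWeightedHomogeneous (wt 𝔏) φ 1) : T.incl 𝔏 (T.mk φ h) = φ := rfl

theorem T.incl_tBasis (β : populated 𝔏) :
    T.incl 𝔏 (tBasis 𝔏 β) = MvPolynomial.monomial β.1 1 := by
  have h : tBasis 𝔏 β = T.mk (MvPolynomial.monomial β.1 1)
      (MvPolynomial.isWeightedHomogeneous_monomial (wt 𝔏) β.1 1 β.2) := by
    apply (tBasis 𝔏).repr.injective
    rw [Module.Basis.repr_self]
    ext γ
    change Finsupp.single β (1 : ℝ) γ = MvPolynomial.coeff γ.1 (MvPolynomial.monomial β.1 1)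
    classical
    rw [MvPolynomial.coeff_monomial, Finsupp.single_apply]
    simp only [Subtype.ext_iff]
  rw [h, T.incl_mk]

theorem tBasis_repr (x : T 𝔏) (β : populated 𝔏) :
    (tBasis 𝔏).repr x β = MvPolynomial.coeff β.1 (T.incl 𝔏 x) := rfl

theorem isWeightedHomogeneous_mkDerivation (f : 𝔏 × ℕ → MvPolynomial (𝔏 × ℕ) ℝ) (m : ℤ)
    (hf : ∀ p, MvPolynomial.IsWeightedHomogeneous (wt 𝔏) (f p) (wt 𝔏 p + m))
    {φ : MvPolynomial (𝔏 × ℕ) ℝ} {n : ℤ}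
    (hφ : MvPolynomial.IsWeightedHomogeneous (wt 𝔏) φ n) :
    MvPolynomial.IsWeightedHomogeneous (wt 𝔏) (MvPolynomial.mkDerivation ℝ f φ) (n + m) := by
  rw [MvPolynomial.as_sum φ, map_sum]
  refine MvPolynomial.IsWeightedHomogeneous.sum _ _ _ fun d hd => ?_
  rw [MvPolynomial.mkDerivation_monomial, Finsupp.smul_sum]
  refine MvPolynomial.IsWeightedHomogeneous.sum _ _ _ fun p hp => ?_
  have hdn : Finsupp.weight (wt 𝔏) d = n := hφ (MvPolynomial.mem_support_iff.1 hd)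
  have hle : Finsupp.single p 1 ≤ d := by
    rw [Finsupp.single_le_iff]
    exact Nat.one_le_iff_ne_zero.2 (Finsupp.mem_support_iff.1 hp)
  have hw : Finsupp.weight (wt 𝔏) (d - Finsupp.single p 1) + wt 𝔏 p = n := by
    rw [← hdn]
    conv_rhs => rw [← tsub_add_cancel_of_le hle, map_add]
    simp [Finsupp.weight_single]
  have h1 := (MvPolynomial.isWeightedHomogeneous_monomial (wt 𝔏)
    (d - Finsupp.single p 1) ((d p : ℕ) : ℝ) rfl).mul (hf p)
  rw [← add_assoc, hw] at h1
  beta_reduce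
  rw [smul_eq_mul, MvPolynomial.smul_eq_C_mul]
  exact h1.C_mul _

theorem isWeightedHomogeneous_D {φ : MvPolynomial (𝔏 × ℕ) ℝ} {n : ℤ}
    (hφ : MvPolynomial.IsWeightedHomogeneous (wt 𝔏) φ n) :
    MvPolynomial.IsWeightedHomogeneous (wt 𝔏) (D 𝔏 φ) (n - 1) := by
  refine isWeightedHomogeneous_mkDerivation _ (-1) (fun p => ?_) hφ
  have h := MvPolynomial.isWeightedHomogeneous_X ℝ (wt 𝔏) (p.1, p.2 + 1)
  have hw : wt 𝔏 (p.1, p.2 + 1) = wt 𝔏 p + -1 := by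
    simp only [wt]
    push_cast
    ring
  rw [hw] at h
  rw [MvPolynomial.smul_eq_C_mul]
  exact h.C_mul _

theorem isWeightedHomogeneous_D_iterate {φ : MvPolynomial (𝔏 × ℕ) ℝ} {n : ℤ}
    (hφ : MvPolynomial.IsWeightedHomogeneous (wt 𝔏) φ n) (k : ℕ) :
    MvPolynomial.IsWeightedHomogeneous (wt 𝔏) ((D 𝔏)^[k] φ) (n - k) := by
  induction k with
  | zero => simpa using hφ
  | succ k ih =>
    rw [Function.iterate_succ_apply']
    have h := isWeightedHomogeneous_D ih
    have e : n - ((k + 1 : ℕ) : ℤ) = n - k - 1 := by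
      push_cast
      ring
    rw [e]
    exact h

/-- The pre-Lie product `π ▷ π' = π D π'` on `T`. -/
instance : Mul (T 𝔏) where
  mul x y := T.mk (T.incl 𝔏 x * D 𝔏 (T.incl 𝔏 y)) (by
    have h := x.isWeightedHomogeneous.mul (isWeightedHomogeneous_D y.isWeightedHomogeneous)
    simpa using h)

theorem T.incl_mul (x y : T 𝔏) : T.incl 𝔏 (x * y) = T.incl 𝔏 x * D 𝔏 (T.incl 𝔏 y) := rfl

instance : LeftPreLieRing (T 𝔏) where
  left_distrib x y z := T.incl_injective (by simp only [T.incl_mul, map_add]; ring)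
  right_distrib x y z := T.incl_injective (by simp only [T.incl_mul, map_add]; ring)
  zero_mul x := T.incl_injective (by simp only [T.incl_mul, map_zero, zero_mul])
  mul_zero x := T.incl_injective (by simp only [T.incl_mul, map_zero, mul_zero])
  assoc_symm' x y z := T.incl_injective (by
    simp only [associator, map_sub, T.incl_mul, Derivation.leibniz, smul_eq_mul]
    ring)

instance : LeftPreLieAlgebra ℝ (T 𝔏) where
  smul_assoc r x y := T.incl_injective (by
    simp only [smul_eq_mul, T.incl_mul, map_smul, smul_mul_assoc])
  smul_comm r x y := T.incl_injective (by
    simp only [smul_eq_mul, T.incl_mul, map_smul, Derivation.map_smul, mul_smul_comm])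

/-! ### The pre-Lie algebra `R` of infinitesimal translations -/

variable (𝔏) in
/-- The space `R` with symbols `r^{(γ,l)}`, `γ` populated and `l ∈ 𝔏`; an element `c` is stored as
the family `c_l = ∑_γ c_{(γ,l)} z^γ`, `l ∈ 𝔏`, of elements of `T` (with `𝔏` finite). -/
def R : Type _ := 𝔏 → T 𝔏

instance : AddCommGroup (R 𝔏) := inferInstanceAs (AddCommGroup (𝔏 → T 𝔏))

instance : Module ℝ (R 𝔏) := inferInstanceAs (Module ℝ (𝔏 → T 𝔏))

/-- The component `c_l ∈ T` of `c ∈ R`. -/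
def R.comp (l : 𝔏) : R 𝔏 →ₗ[ℝ] T 𝔏 := LinearMap.proj (φ := fun _ : 𝔏 => T 𝔏) l

theorem R.ext {x y : R 𝔏} (h : ∀ l, R.comp l x = R.comp l y) : x = y := funext h

variable (𝔏) in
/-- The index set of the basis of `R`. -/
abbrev RIndex : Type _ := populated 𝔏 × 𝔏

variable (𝔏) in
/-- The basis `r^{(γ,l)}` of `R`. -/
def rBasis [Fintype 𝔏] : Module.Basis (RIndex 𝔏) ℝ (R 𝔏) :=
  (Pi.basis fun _ : 𝔏 => tBasis 𝔏).reindex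
    ((Equiv.sigmaEquivProd 𝔏 (populated 𝔏)).trans (Equiv.prodComm 𝔏 (populated 𝔏)))

theorem rBasis_apply [Fintype 𝔏] [DecidableEq 𝔏] (γ : populated 𝔏) (l : 𝔏) :
    rBasis 𝔏 (γ, l) = (Pi.single l (tBasis 𝔏 γ) : 𝔏 → T 𝔏) :=
  (Module.Basis.reindex_apply (Pi.basis fun _ : 𝔏 => tBasis 𝔏)
    ((Equiv.sigmaEquivProd 𝔏 (populated 𝔏)).trans (Equiv.prodComm 𝔏 (populated 𝔏)))
    (γ, l)).trans (Pi.basis_apply (fun _ : 𝔏 => tBasis 𝔏) _)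

theorem rBasis_repr [Fintype 𝔏] (c : R 𝔏) (γ : populated 𝔏) (l : 𝔏) :
    (rBasis 𝔏).repr c (γ, l) = MvPolynomial.coeff γ.1 (T.incl 𝔏 (R.comp l c)) := rfl

/-- The derivation `δ_x = ∑_l ∑_k ((1/k!) D^k x_l) ∂_{z_{(l,k)}}` associated with `x ∈ R`; for
`x = r^{(γ,l)}` it is `∑_k ((1/k!) D^k z^γ) ∂_{z_{(l,k)}}`. -/
def shiftDer (x : R 𝔏) : Derivation ℝ (MvPolynomial (𝔏 × ℕ) ℝ) (MvPolynomial (𝔏 × ℕ) ℝ) :=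
  MvPolynomial.mkDerivation ℝ fun p =>
    ((p.2.factorial : ℝ)⁻¹) • (D 𝔏)^[p.2] (T.incl 𝔏 (R.comp p.1 x))

theorem isWeightedHomogeneous_shiftDer (x : R 𝔏) {φ : MvPolynomial (𝔏 × ℕ) ℝ} {n : ℤ}
    (hφ : MvPolynomial.IsWeightedHomogeneous (wt 𝔏) φ n) :
    MvPolynomial.IsWeightedHomogeneous (wt 𝔏) (shiftDer x φ) n := by
  have h := isWeightedHomogeneous_mkDerivation
    (fun p : 𝔏 × ℕ => ((p.2.factorial : ℝ)⁻¹) • (D 𝔏)^[p.2] (T.incl 𝔏 (R.comp p.1 x))) 0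
    (fun p => by
      rw [MvPolynomial.smul_eq_C_mul, add_zero]
      exact (isWeightedHomogeneous_D_iterate (R.comp p.1 x).isWeightedHomogeneous p.2).C_mul _)
    hφ
  rw [add_zero] at h
  exact h

theorem D_iterate_add (k : ℕ) (φ ψ : MvPolynomial (𝔏 × ℕ) ℝ) :
    (D 𝔏)^[k] (φ + ψ) = (D 𝔏)^[k] φ + (D 𝔏)^[k] ψ :=
  iterate_map_add (D 𝔏) k φ ψ

theorem D_iterate_smul (k : ℕ) (r : ℝ) (φ : MvPolynomial (𝔏 × ℕ) ℝ) :
    (D 𝔏)^[k] (r • φ) = r • (D 𝔏)^[k] φ := by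
  induction k with
  | zero => rfl
  | succ k ih => rw [Function.iterate_succ_apply', ih, Derivation.map_smul,
      Function.iterate_succ_apply']

theorem shiftDer_X (x : R 𝔏) (p : 𝔏 × ℕ) :
    shiftDer x (MvPolynomial.X p) = ((p.2.factorial : ℝ)⁻¹) • (D 𝔏)^[p.2] (T.incl 𝔏 (R.comp p.1 x)) :=
  MvPolynomial.mkDerivation_X _ _ _

theorem D_X (p : 𝔏 × ℕ) :
    D 𝔏 (MvPolynomial.X p) = ((p.2 + 1 : ℕ) : ℝ) • MvPolynomial.X (p.1, p.2 + 1) :=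
  MvPolynomial.mkDerivation_X _ _ _

theorem shiftDer_add (x y : R 𝔏) : shiftDer (x + y) = shiftDer x + shiftDer y := by
  refine MvPolynomial.derivation_ext fun p => ?_
  simp only [Derivation.add_apply, shiftDer_X, map_add, D_iterate_add, smul_add]

theorem shiftDer_smul (r : ℝ) (x : R 𝔏) : shiftDer (r • x) = r • shiftDer x := by
  refine MvPolynomial.derivation_ext fun p => ?_
  simp only [Derivation.smul_apply, shiftDer_X, map_smul, D_iterate_smul]
  rw [smul_comm]

theorem shiftDer_D (x : R 𝔏) (φ : MvPolynomial (𝔏 × ℕ) ℝ) :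
    shiftDer x (D 𝔏 φ) = D 𝔏 (shiftDer x φ) := by
  have h : ⁅shiftDer x, D 𝔏⁆ = 0 := by
    refine MvPolynomial.derivation_ext fun p => ?_
    rw [Derivation.commutator_apply, D_X, Derivation.map_smul, shiftDer_X, shiftDer_X,
      Derivation.map_smul, ← Function.iterate_succ_apply' (D 𝔏), smul_smul, Nat.factorial_succ]
    have hk : ((p.2 + 1 : ℕ) : ℝ) * (((p.2 + 1) * p.2.factorial : ℕ) : ℝ)⁻¹ = (p.2.factorial : ℝ)⁻¹ := by
      have h1 : (p.2.factorial : ℝ) ≠ 0 := by exact_mod_cast Nat.factorial_ne_zero _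
      have h2 : ((p.2 + 1 : ℕ) : ℝ) ≠ 0 := by exact_mod_cast Nat.succ_ne_zero p.2
      push_cast at h2 ⊢
      field_simp
    rw [hk]
    simp
  have h' := congrArg (fun d => d φ) h
  rw [← sub_eq_zero]
  simpa [Derivation.commutator_apply] using h'

theorem shiftDer_D_iterate (x : R 𝔏) (k : ℕ) (φ : MvPolynomial (𝔏 × ℕ) ℝ) :
    shiftDer x ((D 𝔏)^[k] φ) = (D 𝔏)^[k] (shiftDer x φ) := by
  induction k with
  | zero => rfl
  | succ k ih => rw [Function.iterate_succ_apply', shiftDer_D, ih, Function.iterate_succ_apply']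

/-- The endomorphism of `T` induced by `δ_x`. -/
def rhoTildeEnd (x : R 𝔏) : Module.End ℝ (T 𝔏) where
  toFun y := T.mk (shiftDer x (T.incl 𝔏 y))
    (isWeightedHomogeneous_shiftDer x y.isWeightedHomogeneous)
  map_add' y z := T.incl_injective (by simp only [T.incl_mk, map_add])
  map_smul' r y := T.incl_injective (by
    simp only [T.incl_mk, map_smul, Derivation.map_smul, RingHom.id_apply])

theorem incl_rhoTildeEnd (x : R 𝔏) (y : T 𝔏) :
    T.incl 𝔏 (rhoTildeEnd x y) = shiftDer x (T.incl 𝔏 y) := rfl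

/-- The pre-Lie product on `R`: `(x ▷ y)_l = δ_x y_l`, that is
`r^{(γ,l)} ▷ r^{(γ',l')} = ∑_β (∑_k ((1/k!) D^k z^γ) ∂_{(l,k)})_β^{γ'} r^{(β,l')}`. -/
instance : Mul (R 𝔏) where
  mul x y := fun l => rhoTildeEnd x (R.comp l y)

theorem R.comp_mul (l : 𝔏) (x y : R 𝔏) : R.comp l (x * y) = rhoTildeEnd x (R.comp l y) := rfl

theorem shiftDer_lie (x y : R 𝔏) :
    ⁅shiftDer x, shiftDer y⁆ = shiftDer (x * y) - shiftDer (y * x) := by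
  refine MvPolynomial.derivation_ext fun p => ?_
  simp only [Derivation.commutator_apply, Derivation.sub_apply, shiftDer_X, Derivation.map_smul,
    shiftDer_D_iterate, R.comp_mul, incl_rhoTildeEnd]

instance : LeftPreLieRing (R 𝔏) where
  left_distrib x y z := R.ext fun l => by simp only [R.comp_mul, map_add]
  right_distrib x y z := R.ext fun l => T.incl_injective (by
    simp only [R.comp_mul, map_add, incl_rhoTildeEnd, shiftDer_add, Derivation.add_apply])
  zero_mul x := R.ext fun l => T.incl_injective (by
    have h : shiftDer (0 : R 𝔏) = 0 := by simpa using shiftDer_smul (0 : ℝ) (0 : R 𝔏)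
    simp only [R.comp_mul, map_zero, incl_rhoTildeEnd, h, Derivation.zero_apply])
  mul_zero x := R.ext fun l => by simp only [R.comp_mul, map_zero]
  assoc_symm' x y z := R.ext fun l => T.incl_injective (by
    have h := congrArg (fun d => d (T.incl 𝔏 (R.comp l z))) (shiftDer_lie x y)
    simp only [Derivation.commutator_apply, Derivation.sub_apply] at h
    simp only [associator_apply, map_sub, R.comp_mul, incl_rhoTildeEnd]
    linear_combination -h)

instance : LeftPreLieAlgebra ℝ (R 𝔏) where
  smul_assoc r x y := R.ext fun l => T.incl_injective (by
    simp only [smul_eq_mul, R.comp_mul, map_smul, incl_rhoTildeEnd, shiftDer_smul,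
      Derivation.smul_apply])
  smul_comm r x y := R.ext fun l => by simp only [smul_eq_mul, R.comp_mul, map_smul]

section RhoTilde

attribute [local instance 100] LieRing.ofAssociativeRing

/-- The Lie algebra morphism `R → End(T)`, `r^{(γ,l)} ↦ ∑_k ((1/k!) D^k z^γ) ∂_{(l,k)}`. -/
def rhoTildeLie : R 𝔏 →ₗ⁅ℝ⁆ Module.End ℝ (T 𝔏) where
  toFun := rhoTildeEnd
  map_add' x y := LinearMap.ext fun z => T.incl_injective (by
    simp only [LinearMap.add_apply, map_add, incl_rhoTildeEnd, shiftDer_add,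
      Derivation.add_apply])
  map_smul' r x := LinearMap.ext fun z => T.incl_injective (by
    simp only [LinearMap.smul_apply, map_smul, incl_rhoTildeEnd, shiftDer_smul,
      Derivation.smul_apply, RingHom.id_apply])
  map_lie' {x y} := LinearMap.ext fun z => T.incl_injective (by
    have h := congrArg (fun d => d (T.incl 𝔏 z)) (shiftDer_lie x y)
    have h' : shiftDer ⁅x, y⁆ = shiftDer (x * y) - shiftDer (y * x) := by
      have e : ⁅x, y⁆ = x * y + (-1 : ℝ) • (y * x) := by
        rw [Ring.lie_def, neg_one_smul, sub_eq_add_neg]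
      rw [e, shiftDer_add, shiftDer_smul, sub_eq_add_neg]
      congr 1
      exact neg_one_smul ℝ (shiftDer (y * x))
    simp only [Derivation.commutator_apply, ← h'] at h
    simp only [LieRing.of_associative_ring_bracket, LinearMap.sub_apply, Module.End.mul_apply,
      map_sub, incl_rhoTildeEnd]
    exact h.symm)

variable (𝔏) in
/-- The extension of `r^{(γ,l)} ↦ ∑_k ((1/k!) D^k z^γ) ∂_{(l,k)}` to an algebra morphism
`U(R) → End(T)`. -/
def rhoTilde : PreLie.U (R 𝔏) →ₐ[ℝ] Module.End ℝ (T 𝔏) :=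
  UniversalEnvelopingAlgebra.lift ℝ rhoTildeLie

end RhoTilde

/-! ### Rough paths and translations -/

variable (𝔏) in
/-- The formal series `∑_β f_β z^β` over populated multi-indices. -/
abbrev TStar : Type _ := populated 𝔏 → ℝ

/-- The endomorphism `ρ_D(exp_D f)` of `T^*`. -/
def recenter (f : TStar 𝔏) : TStar 𝔏 → TStar 𝔏 :=
  PreLie.charAct PreLie.rho (tBasis 𝔏) (tBasis 𝔏) (PreLie.goExp f)

/-- `α`-rough paths over populated multi-indices (extended to all levels): two-parameter maps
with values in `T^*` which satisfy Chen's relation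
`X_{st} = X_{su} + ρ_D(exp_D X_{su}) X_{ut}` and are such that
`|X_{st,β}| / |t - s|^{α |β|}` is bounded for every `β`. -/
structure IsRoughPath (α : ℝ) (X : unitInterval → unitInterval → TStar 𝔏) : Prop where
  pos : 0 < α
  lt_one : α < 1
  chen : ∀ s u t : unitInterval, s < u → u < t → X s t = X s u + recenter (X s u) (X u t)
  holder : ∀ β : populated 𝔏, ∃ C : ℝ, ∀ s t : unitInterval, s < t →
    |X s t β| / |(t : ℝ) - s| ^ (α * length β.1) ≤ C

/-- The translation map `T_c = ρ̃(exp c)` on `T^*`. -/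
def translate [Fintype 𝔏] (c : R 𝔏) : TStar 𝔏 → TStar 𝔏 :=
  PreLie.charAct (rhoTilde 𝔏) (rBasis 𝔏) (tBasis 𝔏) (PreLie.goExp ((rBasis 𝔏).repr c))

variable (𝔏) in
/-- The index set `{(γ,l) : length γ ≥ 2}`. -/
def RIndexGeTwo : Set (RIndex 𝔏) := {p | 2 ≤ length p.1.1}

/-- The number of occurrences in `β` of letters of `𝔏` outside of `𝔏'`. -/
def lengthOutside (𝔏' : Finset 𝔏) (β : 𝔏 × ℕ →₀ ℕ) : ℕ := by
  classical
  exact β.sum fun p n => if p.1 ∈ 𝔏' then 0 else n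

/-- The index set `{(γ,l) : l ∈ 𝔏', γ has at least one letter outside of 𝔏'}`. -/
def RIndexSub (𝔏' : Finset 𝔏) : Set (RIndex 𝔏) :=
  {p | p.2 ∈ 𝔏' ∧ 0 < lengthOutside 𝔏' p.1.1}

/-- The span of the `r^{(γ,l)}` with `(γ,l) ∈ S` and `length γ ≤ N`. -/
def RTrunc [Fintype 𝔏] (S : Set (RIndex 𝔏)) (N : ℕ) : Submodule ℝ (R 𝔏) :=
  Submodule.span ℝ (rBasis 𝔏 '' {p | p ∈ S ∧ length p.1.1 ≤ N})

/-- `|β|_{𝔏'} = ∑_{l ∈ 𝔏'} α_l ∑_k β(l,k) + α ∑_{l ∉ 𝔏'} ∑_k β(l,k)`. -/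
def subDegree (𝔏' : Finset 𝔏) (α : ℝ) (a : 𝔏 → ℝ) (β : 𝔏 × ℕ →₀ ℕ) : ℝ := by
  classical
  exact β.sum fun p n => (if p.1 ∈ 𝔏' then a p.1 else α) * n

end Defs

end MultiIndex

end

/-! The difficulty is that `ρ_D(exp f)` and `T_c` are defined by infinite sums over Guin–Oudom
elements `A_I`. Normal ordering makes these sums explicit. Take two copies of the variables, the
left one for coefficients and the right one for the argument. An element `a` of the pre-Lie algebra
then acts by a derivation `δ_a` of both copies, and its normally ordered part `ν_a` differentiates
the right copy only. The `ν_a` commute, `[δ_b, ν_a] = ν_{b ▷ a}`, and `δ_a = ν_a` on the right copy.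
These are exactly the relations that turn the recursion for `⊙` into composition with `ν_a`
(`goProd_apply_of_commutator`). Hence `A_I` acts as a divided power of commuting operators and `exp
f` as `∑ ν_f^n / n!` (`sum_goBasis`, `NormalOrder.coeff_charAct`), followed by identification of the
two copies.

For `ρ_D` this gives `∑ f^n D^n / n!`. For `ρ̃` it is Taylor's formula, so `T_c` is the substitution
`z_{(l,k)} ↦ z_{(l,k)} + (1/k!) D^k c_l` (`exists_sum_rightShift_eq`, `translate_apply`). This
substitution is an algebra morphism and commutes with `D`. It therefore commutes with recentering
(`translate_recenter`), and Chen's relation is preserved.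

Finiteness follows from gradings that depend on the letter only. A factor `r^{(γ,l)}` replaces a
letter `l` by the letters of `γ`, so it raises the length by `|γ| - 1` and, for `l ∈ 𝔏'`, the number
of letters outside `𝔏'` by the number of these in `γ`. Under either restriction on the support every
factor raises such a degree by at least one.

For the Hölder bounds, the substitution turns `z^γ` into a polynomial of degree at most `N |γ|`, or
one where only the letters in `𝔏'` cost a factor `N`. So only those `X_γ` contribute to the
`β`-component whose exponent is large enough, and on `[0,1]` a larger exponent gives a stronger
bound. -/

noncomputable section

/-! ### Guin–Oudom exponentials as exponentials of commuting operators. -/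

namespace PreLie

attribute [local instance 100] LieRing.ofAssociativeRing

/-- The multinomial theorem with divided powers. -/
theorem sum_finsuppAntidiag_prod_pow {ι S : Type*} [DecidableEq ι] [CommRing S] [Algebra ℝ S]
    (s : Finset ι) (f : ι → ℝ) (x : ι → S) (n : ℕ) :
    ∑ I ∈ s.finsuppAntidiag n, (I.prod fun i k => f i ^ k) •
        ((I.prod fun _ k => (k.factorial : ℝ))⁻¹ • I.prod fun i k => x i ^ k) =
      (n.factorial : ℝ)⁻¹ • (∑ i ∈ s, f i • x i) ^ n := by
  rw [Finset.sum_pow_eq_sum_piAntidiag, Finset.smul_sum]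
  refine Finset.sum_bij' (fun I _ => ⇑I)
    (fun k hk => Finsupp.onFinset s k (by simpa using (Finset.mem_piAntidiag.1 hk).2))
    ?_ ?_ ?_ ?_ ?_
  · intro I hI
    rw [Finset.mem_finsuppAntidiag] at hI
    rw [Finset.mem_piAntidiag]
    exact ⟨hI.1, fun i hi => hI.2 (Finsupp.mem_support_iff.2 hi)⟩
  · intro k hk
    rw [Finset.mem_finsuppAntidiag]
    exact ⟨(Finset.mem_piAntidiag.1 hk).1, Finsupp.support_onFinset_subset⟩
  · intro I hI
    ext i
    rfl
  · intro k hk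
    rfl
  · intro I hI
    rw [Finset.mem_finsuppAntidiag] at hI
    rw [Finsupp.prod_of_support_subset I hI.2 (fun i k => f i ^ k) (by simp),
      Finsupp.prod_of_support_subset I hI.2 (fun i k => x i ^ k) (by simp),
      Finsupp.prod_of_support_subset I hI.2 (fun _ k => (k.factorial : ℝ)) (by simp)]
    have hm := Nat.multinomial_spec s I
    rw [hI.1] at hm
    have hm' : (∏ i ∈ s, ((I i).factorial : ℝ)) * Nat.multinomial s I = n.factorial := by
      exact_mod_cast hm
    have hn : (n.factorial : ℝ) ≠ 0 := by exact_mod_cast n.factorial_ne_zero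
    have hp : (∏ i ∈ s, ((I i).factorial : ℝ)) ≠ 0 :=
      Finset.prod_ne_zero_iff.2 fun i _ => by exact_mod_cast (I i).factorial_ne_zero
    simp only [smul_pow, Finset.prod_smul]
    rw [← nsmul_eq_mul, ← Nat.cast_smul_eq_nsmul ℝ, smul_smul, smul_smul, smul_smul, ← hm']
    congr 1
    rw [← hm'] at hn
    have := right_ne_zero_of_mul hn
    field_simp

section Operators

variable {L V : Type*} [LeftPreLieRing L] [LeftPreLieAlgebra ℝ L] [AddCommGroup V] [Module ℝ V]

/-- Induction on `u`: the term `u ⊙ (b ▷ a)` subtracted in the recursion for `⊙` cancels the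
commutator `ν (b ▷ a)` that arises when `b` is moved past `ν a`. The condition on `v` starts the
induction at `u = 1`. -/
theorem goProd_apply_of_commutator (Δ : U L →ₐ[ℝ] Module.End ℝ V) (ν : L →ₗ[ℝ] Module.End ℝ V)
    (hcomm : ∀ a b q, Δ (UniversalEnvelopingAlgebra.ι ℝ b) (ν a q) =
      ν a (Δ (UniversalEnvelopingAlgebra.ι ℝ b) q) + ν (b * a) q)
    {v : V} (hv : ∀ a, Δ (UniversalEnvelopingAlgebra.ι ℝ a) v = ν a v) (u : U L) (a : L) :
    Δ (goProd u a) v = ν a (Δ u v) := by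
  revert a
  refine U_induction (P := fun u => ∀ a, Δ (goProd u a) v = ν a (Δ u v)) ?_ ?_ ?_ ?_ u
  · intro a
    rw [goProd_one, hv, map_one, Module.End.one_apply]
  · intro b u hu a
    rw [goProd_ι_mul, map_sub, LinearMap.sub_apply, map_mul, Module.End.mul_apply, hu, hu, hcomm,
      add_sub_cancel_right, map_mul Δ, Module.End.mul_apply]
  · intro u w hu hw a
    rw [goProd_add, map_add, LinearMap.add_apply, hu, hw, map_add, LinearMap.add_apply, map_add]
  · intro r u hu a
    rw [goProd_smul, map_smul, LinearMap.smul_apply, hu, map_smul, LinearMap.smul_apply, map_smul]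

theorem foldl_goProd_mem (Δ : U L →ₐ[ℝ] Module.End ℝ V) (ν : L →ₗ[ℝ] Module.End ℝ V) {v : V}
    (hgo : ∀ u a, Δ (goProd u a) v = ν a (Δ u v)) {ι : Type*} (a : ι → L) (e : ι → ℤ)
    (H : ℤ → Submodule ℝ V) (hH : ∀ i d, ∀ q ∈ H d, ν (a i) q ∈ H (d + e i)) (s : Multiset ι)
    (u : U L) (d : ℤ) (hu : Δ u v ∈ H d) :
    Δ (Multiset.foldl goProd u (s.map a)) v ∈ H (d + (s.map e).sum) := by
  induction s using Multiset.induction_on generalizing u d with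
  | empty => simpa using hu
  | cons i s ih =>
    rw [Multiset.map_cons, Multiset.map_cons, Multiset.foldl_cons, Multiset.sum_cons, ← add_assoc]
    refine ih _ _ ?_
    rw [hgo]
    exact hH i d _ hu

/-- `A_I` acts on `v` as a composition of the operators `ν (a i)`, each shifting the degree by `e
i`. This is the source of all finiteness statements. -/
theorem goBasis_mem (Δ : U L →ₐ[ℝ] Module.End ℝ V) (ν : L →ₗ[ℝ] Module.End ℝ V) {v : V}
    (hgo : ∀ u a, Δ (goProd u a) v = ν a (Δ u v)) {ι : Type*} (a : ι → L) (e : ι → ℤ)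
    (H : ℤ → Submodule ℝ V) (hH : ∀ i d, ∀ q ∈ H d, ν (a i) q ∈ H (d + e i)) (d : ℤ)
    (hv : v ∈ H d) (I : ι →₀ ℕ) :
    Δ (goBasis a I) v ∈ H (d + I.sum fun i n => n * e i) := by
  rw [goBasis, map_smul, LinearMap.smul_apply]
  have h := foldl_goProd_mem Δ ν hgo a e H hH I.toMultiset 1 d (by simpa using hv)
  have hs : (I.toMultiset.map e).sum = I.sum fun i n => (n : ℤ) * e i := by
    rw [Finsupp.toMultiset_map, Finsupp.sum_toMultiset,
      Finsupp.sum_mapDomain_index (by simp) (by intros; exact add_smul _ _ _)]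
    simp
  rw [hs] at h
  exact Submodule.smul_mem _ _ h

theorem foldl_goProd_apply {S : Type*} [CommRing S] [Algebra ℝ S] (Δ : U L →ₐ[ℝ] Module.End ℝ V)
    (ν : L →ₗ[ℝ] S) (θ : S →ₐ[ℝ] Module.End ℝ V) {v : V}
    (hgo : ∀ u a, Δ (goProd u a) v = θ (ν a) (Δ u v)) (s : Multiset L) (u : U L) :
    Δ (Multiset.foldl goProd u s) v = θ (s.map ν).prod (Δ u v) := by
  induction s using Multiset.induction_on generalizing u with
  | empty => simp
  | cons a s ih =>
    rw [Multiset.foldl_cons, ih, hgo, Multiset.map_cons, Multiset.prod_cons, mul_comm, map_mul,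
      Module.End.mul_apply]

theorem sum_goBasis_of_commRing {S ι : Type*} [DecidableEq ι] [CommRing S] [Algebra ℝ S]
    (Δ : U L →ₐ[ℝ] Module.End ℝ V) (ν : L →ₗ[ℝ] S) (θ : S →ₐ[ℝ] Module.End ℝ V) {v : V}
    (hgo : ∀ u a, Δ (goProd u a) v = θ (ν a) (Δ u v)) (a : ι → L) (s : Finset ι) (f : ι → ℝ)
    (n : ℕ) :
    ∑ I ∈ s.finsuppAntidiag n, (I.prod fun i k => f i ^ k) • Δ (goBasis a I) v =
      (n.factorial : ℝ)⁻¹ • (θ (ν (∑ i ∈ s, f i • a i)) ^ n) v := by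
  have h := congrArg (fun w => θ w v) (sum_finsuppAntidiag_prod_pow s f (fun i => ν (a i)) n)
  simp only [map_sum, map_smul, map_pow, LinearMap.smul_apply, LinearMap.sum_apply] at h ⊢
  rw [← h]
  refine Finset.sum_congr rfl fun I _ => ?_
  rw [goBasis, map_smul, LinearMap.smul_apply, foldl_goProd_apply Δ ν θ hgo, Multiset.map_map,
    map_one, Module.End.one_apply, Finsupp.toMultiset_map, Finsupp.prod_toMultiset,
    Finsupp.prod_mapDomain_index (by simp) (by intros; exact pow_add _ _ _)]
  rfl

/-- The multinomial theorem needs a commutative ring; the subalgebra generated by the commuting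
operators `ν a` is one, and its inclusion in the endomorphisms plays the role of `θ`. -/
theorem sum_goBasis {ι : Type*} [DecidableEq ι] (Δ : U L →ₐ[ℝ] Module.End ℝ V)
    (ν : L →ₗ[ℝ] Module.End ℝ V) (hν : ∀ a b, ν a * ν b = ν b * ν a) {v : V}
    (hgo : ∀ u a, Δ (goProd u a) v = ν a (Δ u v)) (a : ι → L) (s : Finset ι) (f : ι → ℝ)
    (n : ℕ) :
    ∑ I ∈ s.finsuppAntidiag n, (I.prod fun i k => f i ^ k) • Δ (goBasis a I) v =
      (n.factorial : ℝ)⁻¹ • (ν (∑ i ∈ s, f i • a i) ^ n) v := by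
  have hc : IsMulCommutative (Algebra.adjoin ℝ (Set.range ν)) :=
    Algebra.isMulCommutative_adjoin ℝ (by rintro _ ⟨x, rfl⟩ _ ⟨y, rfl⟩; exact hν x y)
  let _ : CommRing (Algebra.adjoin ℝ (Set.range ν)) :=
    { (inferInstance : Ring (Algebra.adjoin ℝ (Set.range ν))) with
      mul_comm := fun x y => hc.is_comm.comm x y }
  exact sum_goBasis_of_commRing Δ
    (ν.codRestrict (Subalgebra.toSubmodule (Algebra.adjoin ℝ (Set.range ν)))
      fun x => Algebra.subset_adjoin ⟨x, rfl⟩)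
    (Algebra.adjoin ℝ (Set.range ν)).val hgo a s f n

/-- The exponential of a Lie series acts through finite divided-power sums. -/
theorem charAct_goExp_eq {ι κ : Type*} [DecidableEq ι] (ψ : U L →ₐ[ℝ] Module.End ℝ V)
    (a : Module.Basis ι ℝ L) (v : Module.Basis κ ℝ V) (f : ι → ℝ) (g : κ → ℝ) (j : κ)
    (s : Finset ι) (s' : Finset κ) (M : ℕ)
    (h : ∀ I j', (∀ i ∈ I.support, f i ≠ 0) → structConst ψ a v I j j' ≠ 0 →
      I.support ⊆ s ∧ I.degree < M ∧ j' ∈ s') :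
    charAct ψ a v (goExp f) g j = ∑ n ∈ Finset.range M, ∑ I ∈ s.finsuppAntidiag n,
      (I.prod fun i k => f i ^ k) * v.repr (ψ (goBasis a I) (∑ j' ∈ s', g j' • v j')) j := by
  classical
  have hdisj : Set.PairwiseDisjoint (Finset.range M : Set ℕ) fun n => s.finsuppAntidiag n := by
    intro n _ m _ hnm
    rw [Function.onFun, Finset.disjoint_left]
    intro I hI hI'
    rw [Finset.mem_finsuppAntidiag] at hI hI'
    exact hnm (hI.1.symm.trans hI'.1)
  have hexp : ∀ I : ι →₀ ℕ, goExp f (MvPolynomial.monomial I 1) = I.prod fun i k => f i ^ k := by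
    intro I
    rw [goExp, MvPolynomial.aeval_monomial, map_one, one_mul]
  rw [charAct, finsum_eq_sum_of_support_subset (s := ((Finset.range M).biUnion fun n =>
    s.finsuppAntidiag n) ×ˢ s'), Finset.sum_product, Finset.sum_biUnion hdisj]
  · refine Finset.sum_congr rfl fun n _ => Finset.sum_congr rfl fun I _ => ?_
    simp only [map_sum, map_smul, Finsupp.coe_finsetSum, Finset.sum_apply, Finsupp.smul_apply,
      smul_eq_mul, Finset.mul_sum, hexp, structConst]
    exact Finset.sum_congr rfl fun _ _ => by ring
  · rintro ⟨I, j'⟩ hp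
    simp only [Function.mem_support, hexp, ne_eq, mul_eq_zero, not_or] at hp
    -- A nonzero `f^I` forces `f i ≠ 0` on the support of `I`, so the bounds are only needed for
    -- such `I`. This is how the restriction on the support of `𝐜` enters later.
    obtain ⟨h1, h2, h3⟩ := h I j' (fun i hi h0 => hp.1.1 <| Finset.prod_eq_zero hi
      (by simp only [h0]; exact zero_pow (Finsupp.mem_support_iff.1 hi))) hp.1.2
    simp only [Finset.coe_product, Set.mem_prod, Finset.mem_coe, Finset.mem_biUnion,
      Finset.mem_range, Finset.mem_finsuppAntidiag]
    refine ⟨⟨I.degree, h2, ?_, h1⟩, h3⟩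
    rw [Finsupp.degree_apply]
    exact (Finset.sum_subset h1 fun i _ hi => by simpa using hi).symm

end Operators

section DerivationRep

variable {L Q : Type*} [LeftPreLieRing L] [LeftPreLieAlgebra ℝ L] [CommRing Q] [Algebra ℝ Q]

/-- The representation of the enveloping algebra defined by a family of derivations. -/
def derivationRep (δ : L →ₗ[ℝ] Derivation ℝ Q Q)
    (hδ : ∀ a b, ⁅δ a, δ b⁆ = δ (a * b) - δ (b * a)) : U L →ₐ[ℝ] Module.End ℝ Q :=
  UniversalEnvelopingAlgebra.lift ℝ
    ({ toFun := fun a => (δ a : Q →ₗ[ℝ] Q)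
       map_add' := fun a b => by rw [map_add]; rfl
       map_smul' := fun r a => by rw [map_smul]; rfl
       map_lie' := fun {a b} => by
        have h : δ ⁅a, b⁆ = ⁅δ a, δ b⁆ := by rw [hδ, Ring.lie_def, map_sub]
        change (δ ⁅a, b⁆ : Q →ₗ[ℝ] Q) = _
        rw [h]
        rfl } : L →ₗ⁅ℝ⁆ Module.End ℝ Q)

theorem derivationRep_ι (δ : L →ₗ[ℝ] Derivation ℝ Q Q)
    (hδ : ∀ a b, ⁅δ a, δ b⁆ = δ (a * b) - δ (b * a)) (a : L) (q : Q) :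
    derivationRep δ hδ (UniversalEnvelopingAlgebra.ι ℝ a) q = δ a q := by
  rw [derivationRep, UniversalEnvelopingAlgebra.lift_ι_apply]
  rfl

/-- The map `p` is not injective in the application (it identifies the two copies), so the relation
carried through the induction is `i y = p q`, and compatibility is required for every pair so
related. -/
theorem intertwine_derivationRep (δ : L →ₗ[ℝ] Derivation ℝ Q Q)
    (hδ : ∀ a b, ⁅δ a, δ b⁆ = δ (a * b) - δ (b * a)) {V P : Type*} [AddCommGroup V] [Module ℝ V]
    [AddCommGroup P] [Module ℝ P] (ψ : U L →ₐ[ℝ] Module.End ℝ V) (i : V →ₗ[ℝ] P) (p : Q →ₗ[ℝ] P)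
    (h : ∀ a y q, i y = p q → i (ψ (UniversalEnvelopingAlgebra.ι ℝ a) y) = p (δ a q)) (u : U L)
    (y : V) (q : Q) (hyq : i y = p q) : i (ψ u y) = p (derivationRep δ hδ u q) := by
  refine U_induction (P := fun u => i (ψ u y) = p (derivationRep δ hδ u q)) ?_ ?_ ?_ ?_ u
  · simpa using hyq
  · intro b u hu
    rw [map_mul, Module.End.mul_apply, map_mul, Module.End.mul_apply, derivationRep_ι]
    exact h b _ _ hu
  · intro u w hu hw
    simp only [map_add, LinearMap.add_apply, hu, hw]
  · intro r u hu
    simp only [map_smul, LinearMap.smul_apply, hu]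

end DerivationRep

end PreLie

/-! ### Derivations, algebra morphisms and weighted degrees of polynomials. -/

namespace MvPolynomial

/-- An algebra morphism intertwines two derivations as soon as it does so on the variables. -/
theorem derivation_algHom_apply {σ A : Type*} [CommRing A] [Algebra ℝ A]
    (e : MvPolynomial σ ℝ →ₐ[ℝ] A) (d : Derivation ℝ (MvPolynomial σ ℝ) (MvPolynomial σ ℝ))
    (d' : Derivation ℝ A A) (h : ∀ i, d' (e (X i)) = e (d (X i))) (φ : MvPolynomial σ ℝ) :
    d' (e φ) = e (d φ) := by
  induction φ using MvPolynomial.induction_on with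
  | C r =>
    rw [← MvPolynomial.algebraMap_eq, AlgHom.commutes, Derivation.map_algebraMap,
      Derivation.map_algebraMap, map_zero]
  | add φ ψ hφ hψ => simp only [map_add, hφ, hψ]
  | mul_X φ i hφ =>
    simp only [map_mul, Derivation.leibniz, smul_eq_mul, hφ, h, map_add]

theorem IsWeightedHomogeneous.algHom_apply {σ τ M : Type*} [AddCommMonoid M] {w : σ → M}
    {w' : τ → M} (e : MvPolynomial σ ℝ →ₐ[ℝ] MvPolynomial τ ℝ)
    (he : ∀ i, IsWeightedHomogeneous w' (e (X i)) (w i)) {φ : MvPolynomial σ ℝ} {n : M}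
    (hφ : IsWeightedHomogeneous w φ n) : IsWeightedHomogeneous w' (e φ) n := by
  rw [MvPolynomial.as_sum φ, map_sum]
  refine IsWeightedHomogeneous.sum _ _ _ fun d hd => ?_
  rw [MvPolynomial.monomial_eq, map_mul, ← MvPolynomial.algebraMap_eq, AlgHom.commutes,
    MvPolynomial.algebraMap_eq, map_finsuppProd]
  refine IsWeightedHomogeneous.C_mul ?_ _
  rw [← hφ (MvPolynomial.mem_support_iff.1 hd), Finsupp.weight_apply]
  refine IsWeightedHomogeneous.prod _ _ _ fun i _ => ?_
  beta_reduce
  rw [map_pow]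
  exact (he i).pow _

theorem IsWeightedHomogeneous.derivation_apply {σ M : Type*} [AddCommGroup M] {w : σ → M}
    (d : Derivation ℝ (MvPolynomial σ ℝ) (MvPolynomial σ ℝ)) {m : M}
    (hd : ∀ i, IsWeightedHomogeneous w (d (X i)) (w i + m)) {φ : MvPolynomial σ ℝ} {n : M}
    (hφ : IsWeightedHomogeneous w φ n) : IsWeightedHomogeneous w (d φ) (n + m) := by
  have e : d = mkDerivation ℝ fun i => d (X i) :=
    derivation_ext fun i => by rw [mkDerivation_X]
  rw [e, MvPolynomial.as_sum φ, map_sum]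
  refine IsWeightedHomogeneous.sum _ _ _ fun β hβ => ?_
  rw [mkDerivation_monomial, Finsupp.smul_sum]
  refine IsWeightedHomogeneous.sum _ _ _ fun i hi => ?_
  have hle : Finsupp.single i 1 ≤ β := by
    rw [Finsupp.single_le_iff]
    exact Nat.one_le_iff_ne_zero.2 (Finsupp.mem_support_iff.1 hi)
  have hw : Finsupp.weight w (β - Finsupp.single i 1) + w i = n := by
    rw [← hφ (MvPolynomial.mem_support_iff.1 hβ)]
    conv_rhs => rw [← tsub_add_cancel_of_le hle, map_add]
    simp [Finsupp.weight_single]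
  have h1 := (isWeightedHomogeneous_monomial w
    (β - Finsupp.single i 1) ((β i : ℕ) : ℝ) rfl).mul (hd i)
  rw [← add_assoc, hw] at h1
  beta_reduce
  rw [smul_eq_mul, MvPolynomial.smul_eq_C_mul]
  exact h1.C_mul _

theorem IsWeightedHomogeneous.rename_apply {σ τ M : Type*} [AddCommMonoid M] {w : σ → M}
    {w' : τ → M} (f : σ → τ) (hf : ∀ i, w' (f i) = w i) {φ : MvPolynomial σ ℝ} {n : M}
    (hφ : IsWeightedHomogeneous w φ n) : IsWeightedHomogeneous w' (rename f φ) n :=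
  hφ.algHom_apply (rename f) fun i => by
    rw [rename_X, ← hf]
    exact isWeightedHomogeneous_X ℝ w' (f i)

end MvPolynomial

/-! ### Two copies of the variables. -/

namespace MultiIndex

open MvPolynomial

variable {𝔏 : Type*}

variable (𝔏) in
/-- Polynomials in two copies of the variables: the left copy carries coefficients of differential
operators in normal order, the right copy their argument. -/
abbrev Doubled : Type _ := MvPolynomial ((𝔏 × ℕ) ⊕ (𝔏 × ℕ)) ℝ

variable (𝔏) in
/-- The inclusion of the left copy. -/
abbrev inLeft : MvPolynomial (𝔏 × ℕ) ℝ →ₐ[ℝ] Doubled 𝔏 := rename Sum.inl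

variable (𝔏) in
/-- The inclusion of the right copy. -/
abbrev inRight : MvPolynomial (𝔏 × ℕ) ℝ →ₐ[ℝ] Doubled 𝔏 := rename Sum.inr

variable (𝔏) in
/-- The identification of both copies. -/
abbrev diag : Doubled 𝔏 →ₐ[ℝ] MvPolynomial (𝔏 × ℕ) ℝ := rename (Sum.elim id id)

theorem diag_inLeft (φ : MvPolynomial (𝔏 × ℕ) ℝ) : diag 𝔏 (inLeft 𝔏 φ) = φ := by
  rw [rename_rename, Sum.elim_comp_inl, rename_id_apply]

theorem diag_inRight (φ : MvPolynomial (𝔏 × ℕ) ℝ) : diag 𝔏 (inRight 𝔏 φ) = φ := by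
  rw [rename_rename, Sum.elim_comp_inr, rename_id_apply]

/-- The weight on `𝔏 × ℕ` which only depends on the letter. -/
def letterWeight (W : 𝔏 → ℤ) (p : 𝔏 × ℕ) : ℤ := W p.1

/-- The sum of the two copies of a letter weight. -/
def doubledWeight (W : 𝔏 → ℤ) : (𝔏 × ℕ) ⊕ (𝔏 × ℕ) → ℤ :=
  Sum.elim (letterWeight W) (letterWeight W)

/-- The derivations of polynomials, as endomorphisms. -/
def derivationToEnd (Q : Type*) [CommRing Q] [Algebra ℝ Q] :
    Derivation ℝ Q Q →ₗ[ℝ] Module.End ℝ Q where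
  toFun d := d
  map_add' _ _ := rfl
  map_smul' _ _ := rfl

@[simp] theorem derivationToEnd_apply {Q : Type*} [CommRing Q] [Algebra ℝ Q]
    (d : Derivation ℝ Q Q) (q : Q) : derivationToEnd Q d q = d q := rfl

/-! ### Normally ordered derivations representing a pre-Lie algebra. -/

section Abstract

open PreLie

variable {L : Type*} [LeftPreLieRing L] [LeftPreLieAlgebra ℝ L]

/-- A family of derivations `δ` of the doubled polynomials representing a pre-Lie algebra,
together with the family `ν` of its normally ordered parts, and the action `ψ` on `T` which they
induce on the diagonal. -/
structure NormalOrder (ψ : U L →ₐ[ℝ] Module.End ℝ (T 𝔏)) where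
  /-- the full derivations -/
  δ : L →ₗ[ℝ] Derivation ℝ (Doubled 𝔏) (Doubled 𝔏)
  /-- the normally ordered parts -/
  ν : L →ₗ[ℝ] Derivation ℝ (Doubled 𝔏) (Doubled 𝔏)
  lie_δ : ∀ a b, ⁅δ a, δ b⁆ = δ (a * b) - δ (b * a)
  lie_δ_ν : ∀ b a, ⁅δ b, ν a⁆ = ν (b * a)
  lie_ν : ∀ a b, ⁅ν a, ν b⁆ = 0
  inRight_eq : ∀ a φ, δ a (inRight 𝔏 φ) = ν a (inRight 𝔏 φ)
  diag_δ : ∀ a y q, T.incl 𝔏 y = diag 𝔏 q →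
    T.incl 𝔏 (ψ (UniversalEnvelopingAlgebra.ι ℝ a) y) = diag 𝔏 (δ a q)

namespace NormalOrder

variable {ψ : U L →ₐ[ℝ] Module.End ℝ (T 𝔏)} (A : NormalOrder ψ)

/-- Computations with `ψ u` can be made in the doubled polynomials, starting from the argument in
the right copy and identifying the copies only at the end. -/
theorem incl_apply (u : U L) (y : T 𝔏) : T.incl 𝔏 (ψ u y) =
    diag 𝔏 (derivationRep A.δ A.lie_δ u (inRight 𝔏 (T.incl 𝔏 y))) :=
  intertwine_derivationRep A.δ A.lie_δ ψ (T.incl 𝔏) (diag 𝔏).toLinearMap A.diag_δ u y _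
    (diag_inRight _).symm

theorem goProd_apply (φ : MvPolynomial (𝔏 × ℕ) ℝ) (u : U L) (a : L) :
    derivationRep A.δ A.lie_δ (goProd u a) (inRight 𝔏 φ) =
      (derivationToEnd _ ∘ₗ A.ν) a (derivationRep A.δ A.lie_δ u (inRight 𝔏 φ)) := by
  refine goProd_apply_of_commutator _ _ (fun a b q => ?_) (fun a => ?_) u a
  · have h := congrArg (fun d => d q) (A.lie_δ_ν b a)
    simp only [Derivation.commutator_apply] at h
    simp only [derivationRep_ι, LinearMap.comp_apply, derivationToEnd_apply, ← h]
    abel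
  · rw [derivationRep_ι, A.inRight_eq]
    rfl

/-- Homogeneity of the structure constants. -/
theorem weight_eq_of_structConst_ne_zero {ι : Type*} (a : Module.Basis ι ℝ L) (W : 𝔏 → ℤ)
    (e : ι → ℤ) (he : ∀ i p, IsWeightedHomogeneous (doubledWeight W) (A.ν (a i) (X p))
      (doubledWeight W p + e i)) {I : ι →₀ ℕ} {β γ : populated 𝔏}
    (h : structConst ψ a (tBasis 𝔏) I β γ ≠ 0) :
    Finsupp.weight (letterWeight W) β.1 =
      Finsupp.weight (letterWeight W) γ.1 + I.sum fun i n => n * e i := by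
  have hmem := goBasis_mem (derivationRep A.δ A.lie_δ) (derivationToEnd _ ∘ₗ A.ν)
    (v := inRight 𝔏 (T.incl 𝔏 (tBasis 𝔏 γ))) (A.goProd_apply _) a e
    (weightedHomogeneousSubmodule ℝ (doubledWeight W))
    (fun i d q hq => IsWeightedHomogeneous.derivation_apply _ (he i) hq)
    (Finsupp.weight (letterWeight W) γ.1) ?_ I
  · have h1 : IsWeightedHomogeneous (letterWeight W) (diag 𝔏 _) _ :=
      IsWeightedHomogeneous.rename_apply (w := doubledWeight W) (w' := letterWeight W)
        (Sum.elim id id) (by rintro (p | p) <;> rfl) hmem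
    rw [← A.incl_apply] at h1
    exact h1 h
  · refine IsWeightedHomogeneous.rename_apply (w := letterWeight W) (w' := doubledWeight W) _
      (fun p => rfl) ?_
    rw [T.incl_tBasis]
    exact isWeightedHomogeneous_monomial _ _ _ rfl

/-- The data `s`, `s'`, `M` form a finite window outside of which no term contributes to the
coefficient `β`. Inside it, the terms with `|I| = n` add up to the `n`-th divided power of the
single derivation `ν (∑ f i • a i)`. -/
theorem coeff_charAct {ι : Type*} [DecidableEq ι] (a : Module.Basis ι ℝ L) (f : ι → ℝ)
    (g : TStar 𝔏) (β : populated 𝔏) (s : Finset ι) (s' : Finset (populated 𝔏)) (M : ℕ)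
    (h : ∀ I j', (∀ i ∈ I.support, f i ≠ 0) → structConst ψ a (tBasis 𝔏) I β j' ≠ 0 →
      I.support ⊆ s ∧ I.degree < M ∧ j' ∈ s') :
    charAct ψ a (tBasis 𝔏) (goExp f) g β = coeff β.1 (diag 𝔏 (∑ n ∈ Finset.range M,
      (n.factorial : ℝ)⁻¹ • (A.ν (∑ i ∈ s, f i • a i))^[n]
        (inRight 𝔏 (T.incl 𝔏 (∑ γ ∈ s', g γ • tBasis 𝔏 γ))))) := by
  rw [charAct_goExp_eq ψ a (tBasis 𝔏) f g β s s' M h, map_sum, coeff_sum]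
  refine Finset.sum_congr rfl fun n _ => ?_
  have hs := sum_goBasis (derivationRep A.δ A.lie_δ) (derivationToEnd _ ∘ₗ A.ν) (fun a b => by
      refine LinearMap.ext fun q => ?_
      have h := congrArg (fun d => d q) (A.lie_ν a b)
      simp only [Derivation.commutator_apply, Derivation.zero_apply] at h
      exact sub_eq_zero.1 h)
    (v := inRight 𝔏 (T.incl 𝔏 (∑ γ ∈ s', g γ • tBasis 𝔏 γ))) (A.goProd_apply _) a s f n
  rw [Module.End.pow_apply] at hs
  change _ = (n.factorial : ℝ)⁻¹ • (A.ν (∑ i ∈ s, f i • a i))^[n] _ at hs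
  rw [← hs, map_sum, coeff_sum]
  refine Finset.sum_congr rfl fun I _ => ?_
  rw [map_smul, ← A.incl_apply, coeff_smul, tBasis_repr, smul_eq_mul]

end NormalOrder

end Abstract

open PreLie

/-! ### Normal ordering for `ρ_D` -/

variable (𝔏) in
/-- The derivation `D` in both copies of the variables. -/
def bothD : Derivation ℝ (Doubled 𝔏) (Doubled 𝔏) :=
  mkDerivation ℝ (Sum.elim (fun p => inLeft 𝔏 (D 𝔏 (X p))) fun p => inRight 𝔏 (D 𝔏 (X p)))

variable (𝔏) in
/-- The derivation `D` in the right copy of the variables. -/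
def rightD : Derivation ℝ (Doubled 𝔏) (Doubled 𝔏) :=
  mkDerivation ℝ (Sum.elim 0 fun p => inRight 𝔏 (D 𝔏 (X p)))

theorem bothD_inLeft (φ : MvPolynomial (𝔏 × ℕ) ℝ) :
    bothD 𝔏 (inLeft 𝔏 φ) = inLeft 𝔏 (D 𝔏 φ) :=
  derivation_algHom_apply _ _ _ (fun p => by rw [rename_X, bothD, mkDerivation_X]; rfl) φ

theorem bothD_inRight (φ : MvPolynomial (𝔏 × ℕ) ℝ) :
    bothD 𝔏 (inRight 𝔏 φ) = inRight 𝔏 (D 𝔏 φ) :=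
  derivation_algHom_apply _ _ _ (fun p => by rw [rename_X, bothD, mkDerivation_X]; rfl) φ

theorem rightD_inRight (φ : MvPolynomial (𝔏 × ℕ) ℝ) :
    rightD 𝔏 (inRight 𝔏 φ) = inRight 𝔏 (D 𝔏 φ) :=
  derivation_algHom_apply _ _ _ (fun p => by rw [rename_X, rightD, mkDerivation_X]; rfl) φ

theorem rightD_inLeft (φ : MvPolynomial (𝔏 × ℕ) ℝ) : rightD 𝔏 (inLeft 𝔏 φ) = 0 := by
  rw [derivation_algHom_apply (inLeft 𝔏) 0 (rightD 𝔏)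
    (fun p => by rw [rename_X, rightD, mkDerivation_X]; simp) φ, Derivation.zero_apply, map_zero]

theorem diag_bothD (q : Doubled 𝔏) : diag 𝔏 (bothD 𝔏 q) = D 𝔏 (diag 𝔏 q) := by
  refine (derivation_algHom_apply (diag 𝔏) (bothD 𝔏) (D 𝔏) (fun p => ?_) q).symm
  rcases p with p | p
  · rw [rename_X, bothD, mkDerivation_X]
    exact (diag_inLeft _).symm
  · rw [rename_X, bothD, mkDerivation_X]
    exact (diag_inRight _).symm

theorem commutator_bothD_rightD (q : Doubled 𝔏) :
    bothD 𝔏 (rightD 𝔏 q) = rightD 𝔏 (bothD 𝔏 q) := by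
  have h : ⁅bothD 𝔏, rightD 𝔏⁆ = 0 := by
    refine derivation_ext fun p => ?_
    rw [Derivation.commutator_apply]
    rcases p with p | p
    · rw [show (X (Sum.inl p) : Doubled 𝔏) = inLeft 𝔏 (X p) from (rename_X _ _).symm,
        rightD_inLeft, bothD_inLeft, rightD_inLeft]
      simp
    · rw [show (X (Sum.inr p) : Doubled 𝔏) = inRight 𝔏 (X p) from (rename_X _ _).symm,
        rightD_inRight, bothD_inRight, bothD_inRight, rightD_inRight]
      simp
  have h' := congrArg (fun d => d q) h
  rw [← sub_eq_zero]
  simpa only [Derivation.commutator_apply, Derivation.zero_apply] using h'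

theorem rho_ι_apply (x y : T 𝔏) : rho (UniversalEnvelopingAlgebra.ι ℝ x) y = x * y := by
  rw [rho, UniversalEnvelopingAlgebra.lift_ι_apply]
  rfl

variable (𝔏) in
/-- The normal ordering of `ρ_D`. -/
def rhoNormalOrder : NormalOrder (rho (L := T 𝔏)) where
  δ :=
    { toFun := fun x => inLeft 𝔏 (T.incl 𝔏 x) • bothD 𝔏
      map_add' := fun x y => by rw [map_add, map_add, add_smul]
      map_smul' := fun r x => by rw [map_smul, map_smul, smul_assoc]; rfl }
  ν :=
    { toFun := fun x => inLeft 𝔏 (T.incl 𝔏 x) • rightD 𝔏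
      map_add' := fun x y => by rw [map_add, map_add, add_smul]
      map_smul' := fun r x => by rw [map_smul, map_smul, smul_assoc]; rfl }
  lie_δ a b := by
    ext1 p
    simp only [LinearMap.coe_mk, AddHom.coe_mk, Derivation.commutator_apply, Derivation.smul_apply,
      Derivation.sub_apply, smul_eq_mul, Derivation.leibniz, bothD_inLeft, T.incl_mul, map_mul]
    ring
  lie_δ_ν b a := by
    ext1 p
    simp only [LinearMap.coe_mk, AddHom.coe_mk, Derivation.commutator_apply, Derivation.smul_apply,
      smul_eq_mul, Derivation.leibniz, bothD_inLeft, rightD_inLeft,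
      commutator_bothD_rightD, T.incl_mul, map_mul]
    ring
  lie_ν a b := by
    ext1 p
    simp only [LinearMap.coe_mk, AddHom.coe_mk, Derivation.commutator_apply, Derivation.smul_apply,
      Derivation.zero_apply, smul_eq_mul, Derivation.leibniz, rightD_inLeft]
    ring
  inRight_eq a φ := by
    simp only [LinearMap.coe_mk, AddHom.coe_mk, Derivation.smul_apply, bothD_inRight,
      rightD_inRight]
  diag_δ a y q h := by
    simp only [LinearMap.coe_mk, AddHom.coe_mk, Derivation.smul_apply, rho_ι_apply, T.incl_mul,
      smul_eq_mul, map_mul, diag_bothD, diag_inLeft, h]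

theorem rhoNormalOrder_ν (x : T 𝔏) (q : Doubled 𝔏) :
    (rhoNormalOrder 𝔏).ν x q = inLeft 𝔏 (T.incl 𝔏 x) * rightD 𝔏 q := rfl

/-- The coefficient sits in the left copy, which `rightD` annihilates, so no derivative falls on
earlier factors. -/
theorem rhoNormalOrder_ν_iterate (x : T 𝔏) (φ : MvPolynomial (𝔏 × ℕ) ℝ) (n : ℕ) :
    ((rhoNormalOrder 𝔏).ν x)^[n] (inRight 𝔏 φ) =
      inLeft 𝔏 (T.incl 𝔏 x ^ n) * inRight 𝔏 ((D 𝔏)^[n] φ) := by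
  induction n with
  | zero => simp
  | succ n ih =>
    rw [Function.iterate_succ_apply', ih, rhoNormalOrder_ν, Derivation.leibniz, rightD_inLeft,
      rightD_inRight, Function.iterate_succ_apply', pow_succ, map_mul, smul_zero, add_zero,
      smul_eq_mul]
    ring

/-! ### Normal ordering for the translations -/

/-- The derivation `δ_x` acting in both copies of the variables, with coefficients on the left. -/
def bothShift (x : R 𝔏) : Derivation ℝ (Doubled 𝔏) (Doubled 𝔏) :=
  mkDerivation ℝ (Sum.elim (fun p => inLeft 𝔏 (shiftDer x (X p)))
    fun p => inLeft 𝔏 (shiftDer x (X p)))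

/-- The derivation `δ_x` acting on the right copy of the variables, with coefficients on the
left. -/
def rightShift (x : R 𝔏) : Derivation ℝ (Doubled 𝔏) (Doubled 𝔏) :=
  mkDerivation ℝ (Sum.elim 0 fun p => inLeft 𝔏 (shiftDer x (X p)))

theorem bothShift_X_inl (x : R 𝔏) (p : 𝔏 × ℕ) :
    bothShift x (X (Sum.inl p)) = inLeft 𝔏 (shiftDer x (X p)) := mkDerivation_X _ _ _

theorem bothShift_X_inr (x : R 𝔏) (p : 𝔏 × ℕ) :
    bothShift x (X (Sum.inr p)) = inLeft 𝔏 (shiftDer x (X p)) := mkDerivation_X _ _ _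

theorem rightShift_X_inl (x : R 𝔏) (p : 𝔏 × ℕ) :
    rightShift x (X (Sum.inl p)) = 0 := mkDerivation_X _ _ _

theorem rightShift_X_inr (x : R 𝔏) (p : 𝔏 × ℕ) :
    rightShift x (X (Sum.inr p)) = inLeft 𝔏 (shiftDer x (X p)) := mkDerivation_X _ _ _

theorem bothShift_inLeft (x : R 𝔏) (φ : MvPolynomial (𝔏 × ℕ) ℝ) :
    bothShift x (inLeft 𝔏 φ) = inLeft 𝔏 (shiftDer x φ) :=
  derivation_algHom_apply _ _ _ (fun p => by rw [rename_X, bothShift_X_inl]) φ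

theorem rightShift_inLeft (x : R 𝔏) (φ : MvPolynomial (𝔏 × ℕ) ℝ) :
    rightShift x (inLeft 𝔏 φ) = 0 := by
  rw [derivation_algHom_apply (inLeft 𝔏) 0 (rightShift x)
    (fun p => by rw [rename_X, rightShift_X_inl]; simp) φ, Derivation.zero_apply, map_zero]

theorem diag_bothShift (x : R 𝔏) (q : Doubled 𝔏) :
    diag 𝔏 (bothShift x q) = shiftDer x (diag 𝔏 q) := by
  refine (derivation_algHom_apply (diag 𝔏) (bothShift x) (shiftDer x) (fun p => ?_) q).symm
  rcases p with p | p
  · rw [rename_X, bothShift_X_inl, diag_inLeft]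
    rfl
  · rw [rename_X, bothShift_X_inr, diag_inLeft]
    rfl

/-- As `δ_x` commutes with `D`, it acts on `(1/k!) D^k y_l` through `δ_x y_l = (x ▷ y)_l`. Both
commutator relations of the normal ordering reduce to this identity. -/
theorem shiftDer_shiftDer_X (x y : R 𝔏) (p : 𝔏 × ℕ) :
    shiftDer x (shiftDer y (X p)) = shiftDer (x * y) (X p) := by
  rw [shiftDer_X, Derivation.map_smul, shiftDer_D_iterate, ← incl_rhoTildeEnd, ← R.comp_mul,
    ← shiftDer_X]

theorem rhoTilde_ι_apply (x : R 𝔏) (y : T 𝔏) :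
    rhoTilde 𝔏 (UniversalEnvelopingAlgebra.ι ℝ x) y = rhoTildeEnd x y := by
  rw [rhoTilde, UniversalEnvelopingAlgebra.lift_ι_apply]
  rfl

variable (𝔏) in
/-- The normal ordering of `ρ̃`. -/
def rhoTildeNormalOrder : NormalOrder (rhoTilde 𝔏) where
  δ :=
    { toFun := bothShift
      map_add' := fun x y => derivation_ext fun p => by
        rcases p with p | p <;>
          simp only [Derivation.add_apply, bothShift_X_inl, bothShift_X_inr, shiftDer_add, map_add]
      map_smul' := fun r x => derivation_ext fun p => by
        rcases p with p | p <;>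
          simp only [Derivation.smul_apply, bothShift_X_inl, bothShift_X_inr, shiftDer_smul,
            map_smul, RingHom.id_apply] }
  ν :=
    { toFun := rightShift
      map_add' := fun x y => derivation_ext fun p => by
        rcases p with p | p <;>
          simp only [Derivation.add_apply, rightShift_X_inl, rightShift_X_inr, shiftDer_add,
            map_add, add_zero]
      map_smul' := fun r x => derivation_ext fun p => by
        rcases p with p | p <;>
          simp only [Derivation.smul_apply, rightShift_X_inl, rightShift_X_inr, shiftDer_smul,
            map_smul, RingHom.id_apply, smul_zero] }
  lie_δ a b := derivation_ext fun p => by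
    rcases p with p | p <;>
      simp only [LinearMap.coe_mk, AddHom.coe_mk, Derivation.commutator_apply,
        Derivation.sub_apply, bothShift_X_inl, bothShift_X_inr, bothShift_inLeft,
        shiftDer_shiftDer_X]
  lie_δ_ν b a := derivation_ext fun p => by
    rcases p with p | p <;>
      simp only [LinearMap.coe_mk, AddHom.coe_mk, Derivation.commutator_apply,
        rightShift_X_inl, rightShift_X_inr, bothShift_X_inl, bothShift_X_inr, bothShift_inLeft,
        rightShift_inLeft, shiftDer_shiftDer_X, map_zero, sub_zero]
  lie_ν a b := derivation_ext fun p => by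
    rcases p with p | p <;>
      simp only [LinearMap.coe_mk, AddHom.coe_mk, Derivation.commutator_apply,
        rightShift_X_inl, rightShift_X_inr, rightShift_inLeft, map_zero, sub_zero,
        Derivation.zero_apply]
  inRight_eq a φ := by
    have h : ∀ d : Derivation ℝ (Doubled 𝔏) (Doubled 𝔏), (∀ p, d (X (Sum.inr p)) = 0) →
        d (inRight 𝔏 φ) = 0 := fun d hd => by
      rw [derivation_algHom_apply (inRight 𝔏) 0 d (fun p => by rw [rename_X, hd]; simp) φ,
        Derivation.zero_apply, map_zero]
    refine sub_eq_zero.1 (h (bothShift a - rightShift a) fun p => ?_)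
    rw [Derivation.sub_apply, bothShift_X_inr, rightShift_X_inr, sub_self]
  diag_δ a y q h := by
    rw [rhoTilde_ι_apply, incl_rhoTildeEnd, h]
    exact (diag_bothShift a q).symm

theorem rhoTildeNormalOrder_ν (x : R 𝔏) : (rhoTildeNormalOrder 𝔏).ν x = rightShift x := rfl

/-- The substitution `z_{(l,k)} ↦ z_{(l,k)} + (1/k!) D^k x_l`. -/
def shiftHom (x : R 𝔏) : MvPolynomial (𝔏 × ℕ) ℝ →ₐ[ℝ] MvPolynomial (𝔏 × ℕ) ℝ :=
  aeval fun p => X p + shiftDer x (X p)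

theorem shiftHom_X (x : R 𝔏) (p : 𝔏 × ℕ) : shiftHom x (X p) = X p + shiftDer x (X p) :=
  aeval_X _ _

/-- Substitution of `q + t • rightShift x q` for the variables `q`. -/
def taylorHom (x : R 𝔏) : Doubled 𝔏 →ₐ[ℝ] Polynomial (Doubled 𝔏) :=
  aeval fun p => Polynomial.C (X p) + Polynomial.X * Polynomial.C (rightShift x (X p))

theorem taylorHom_inLeft (x : R 𝔏) (φ : MvPolynomial (𝔏 × ℕ) ℝ) :
    taylorHom x (inLeft 𝔏 φ) = Polynomial.C (inLeft 𝔏 φ) := by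
  have h : (taylorHom x).comp (inLeft 𝔏) =
      ((Polynomial.CAlgHom (R := Doubled 𝔏) (A := Doubled 𝔏)).restrictScalars ℝ).comp (inLeft 𝔏) := by
    ext1 p
    simp only [AlgHom.comp_apply, rename_X, taylorHom, aeval_X, rightShift_X_inl]
    simp
  exact congrArg (fun e => e φ) h

/-- The differential equation of the flow of `rightShift x`. It suffices to check it on the
variables, where `rightShift x` takes values in the left copy, which the flow fixes. -/
theorem derivative_taylorHom (x : R 𝔏) (q : Doubled 𝔏) :
    Polynomial.derivative (taylorHom x q) = taylorHom x (rightShift x q) := by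
  refine derivation_algHom_apply (taylorHom x) (rightShift x)
    (Polynomial.derivative'.restrictScalars ℝ) (fun p => ?_) q
  change Polynomial.derivative (taylorHom x (X p)) = _
  have h : taylorHom x (rightShift x (X p)) = Polynomial.C (rightShift x (X p)) := by
    rcases p with p | p
    · rw [rightShift_X_inl, map_zero, map_zero]
    · rw [rightShift_X_inr, taylorHom_inLeft]
  rw [h, taylorHom, aeval_X]
  simp

/-- Taylor's formula: the constant term is the value at `t = 0`, where the substitution is the
identity, and the differential equation gives the recursion for the next coefficient. -/
theorem coeff_taylorHom (x : R 𝔏) (n : ℕ) (q : Doubled 𝔏) :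
    (taylorHom x q).coeff n = (n.factorial : ℝ)⁻¹ • (rightShift x)^[n] q := by
  induction n generalizing q with
  | zero =>
    rw [Polynomial.coeff_zero_eq_eval_zero]
    have h : ((Polynomial.aeval (0 : Doubled 𝔏)).restrictScalars ℝ).comp (taylorHom x) =
        AlgHom.id ℝ _ := by
      ext1 p
      simp [taylorHom]
    have h' := congrArg (fun e => e q) h
    simpa [Polynomial.aeval_def, Polynomial.eval₂_eq_eval_map] using h'
  | succ n ih =>
    have h := congrArg (fun r => r.coeff n) (derivative_taylorHom x q)
    simp only [Polynomial.coeff_derivative, ih] at h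
    rw [Function.iterate_succ_apply, Nat.factorial_succ]
    have hn : ((n : ℝ) + 1) ≠ 0 := by positivity
    have h2 : (taylorHom x q).coeff (n + 1) * ((n : Doubled 𝔏) + 1) =
        ((n : ℝ) + 1) • (taylorHom x q).coeff (n + 1) := by
      rw [Algebra.smul_def, mul_comm]
      simp
    rw [h2] at h
    rw [Nat.cast_mul, mul_inv, mul_smul, ← h, smul_smul]
    push_cast
    rw [inv_mul_cancel₀ hn, one_smul]

/-- The exponential series is the value at `t = 1` of the polynomial `taylorHom x (inRight 𝔏 φ)`,
hence a finite sum. After identification of the copies the result is multiplicative in `φ`, so it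
can be compared with the substitution on the variables. -/
theorem exists_sum_rightShift_eq (x : R 𝔏) (φ : MvPolynomial (𝔏 × ℕ) ℝ) :
    ∃ M₀, ∀ M, M₀ ≤ M → diag 𝔏 (∑ n ∈ Finset.range M,
      (n.factorial : ℝ)⁻¹ • (rightShift x)^[n] (inRight 𝔏 φ)) = shiftHom x φ := by
  refine ⟨(taylorHom x (inRight 𝔏 φ)).natDegree + 1, fun M hM => ?_⟩
  simp only [← coeff_taylorHom]
  have h1 := Polynomial.eval_eq_sum_range' (Nat.lt_of_succ_le hM) 1
  simp only [one_pow, mul_one] at h1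
  rw [← h1]
  have h : (diag 𝔏).comp (((Polynomial.aeval (1 : Doubled 𝔏)).restrictScalars ℝ).comp
      ((taylorHom x).comp (inRight 𝔏))) = shiftHom x := by
    ext1 p
    simp only [AlgHom.comp_apply, rename_X, taylorHom, aeval_X, rightShift_X_inr, shiftHom_X,
      AlgHom.coe_restrictScalars', map_add, map_mul, Polynomial.aeval_C, Polynomial.aeval_X,
      one_mul, Algebra.algebraMap_self, RingHom.id_apply, diag_inLeft]
    rfl
  have h' := congrArg (fun e => e φ) h
  simpa [Polynomial.aeval_def, Polynomial.eval₂_eq_eval_map] using h'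

/-- Checked on the variables, where it amounts to `δ_x` commuting with `D`; this is what the
coefficients `(1/k!) D^k` are designed for. -/
theorem shiftHom_D (x : R 𝔏) (φ : MvPolynomial (𝔏 × ℕ) ℝ) :
    shiftHom x (D 𝔏 φ) = D 𝔏 (shiftHom x φ) := by
  refine (derivation_algHom_apply (shiftHom x) (D 𝔏) (D 𝔏) (fun p => ?_) φ).symm
  rw [shiftHom_X, map_add, ← shiftDer_D, D_X, Derivation.map_smul,
    map_smul (shiftHom x), shiftHom_X, smul_add]

theorem shiftHom_D_iterate (x : R 𝔏) (n : ℕ) (φ : MvPolynomial (𝔏 × ℕ) ℝ) :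
    shiftHom x ((D 𝔏)^[n] φ) = (D 𝔏)^[n] (shiftHom x φ) := by
  induction n with
  | zero => rfl
  | succ n ih => rw [Function.iterate_succ_apply', shiftHom_D, ih, Function.iterate_succ_apply']

/-! ### Gradings and finiteness -/

theorem weight_one_eq_length (β : 𝔏 × ℕ →₀ ℕ) :
    Finsupp.weight (letterWeight fun _ : 𝔏 => 1) β = (length β : ℤ) := by
  rw [Finsupp.weight_apply, length, Finsupp.sum, Finsupp.sum, Nat.cast_sum]
  exact Finset.sum_congr rfl fun p _ => by simp [letterWeight]

theorem weight_indicator_eq_lengthOutside [DecidableEq 𝔏] (𝔏' : Finset 𝔏) (β : 𝔏 × ℕ →₀ ℕ) :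
    Finsupp.weight (letterWeight fun l : 𝔏 => if l ∈ 𝔏' then 0 else 1) β =
      (lengthOutside 𝔏' β : ℤ) := by
  rw [Finsupp.weight_apply, lengthOutside, Finsupp.sum, Finsupp.sum, Nat.cast_sum]
  refine Finset.sum_congr rfl fun p _ => ?_
  by_cases h : p.1 ∈ 𝔏' <;> simp [letterWeight, h]

theorem isWeightedHomogeneous_D_letterWeight (W : 𝔏 → ℤ) {φ : MvPolynomial (𝔏 × ℕ) ℝ} {n : ℤ}
    (hφ : IsWeightedHomogeneous (letterWeight W) φ n) :
    IsWeightedHomogeneous (letterWeight W) (D 𝔏 φ) n := by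
  have h := hφ.derivation_apply (D 𝔏) (m := 0) fun p => by
    rw [D_X, MvPolynomial.smul_eq_C_mul, add_zero]
    exact (isWeightedHomogeneous_X ℝ (letterWeight W) (p.1, p.2 + 1)).C_mul _
  rwa [add_zero] at h

theorem isWeightedHomogeneous_D_iterate_letterWeight (W : 𝔏 → ℤ) {φ : MvPolynomial (𝔏 × ℕ) ℝ}
    {n : ℤ} (hφ : IsWeightedHomogeneous (letterWeight W) φ n) (k : ℕ) :
    IsWeightedHomogeneous (letterWeight W) ((D 𝔏)^[k] φ) n := by
  induction k with
  | zero => exact hφ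
  | succ k ih =>
    rw [Function.iterate_succ_apply']
    exact isWeightedHomogeneous_D_letterWeight W ih

theorem isWeightedHomogeneous_incl_tBasis (W : 𝔏 → ℤ) (γ : populated 𝔏) :
    IsWeightedHomogeneous (letterWeight W) (T.incl 𝔏 (tBasis 𝔏 γ))
      (Finsupp.weight (letterWeight W) γ.1) := by
  rw [T.incl_tBasis]
  exact isWeightedHomogeneous_monomial _ _ _ rfl

theorem rho_weight_eq (W : 𝔏 → ℤ) {I : populated 𝔏 →₀ ℕ} {β γ : populated 𝔏}
    (h : structConst rho (tBasis 𝔏) (tBasis 𝔏) I β γ ≠ 0) :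
    Finsupp.weight (letterWeight W) β.1 = Finsupp.weight (letterWeight W) γ.1 +
      I.sum fun i n => n * Finsupp.weight (letterWeight W) i.1 := by
  refine (rhoNormalOrder 𝔏).weight_eq_of_structConst_ne_zero (tBasis 𝔏) W _ (fun i p => ?_) h
  rw [rhoNormalOrder_ν, add_comm]
  refine ((isWeightedHomogeneous_incl_tBasis W i).rename_apply Sum.inl fun _ => rfl).mul ?_
  rcases p with p | p
  · rw [rightD, mkDerivation_X]
    exact isWeightedHomogeneous_zero _ _ _
  · rw [← rename_X, rightD_inRight]
    refine IsWeightedHomogeneous.rename_apply (w := letterWeight W) (n := W p.1) Sum.inr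
      (fun _ => rfl) ?_
    exact isWeightedHomogeneous_D_letterWeight W (isWeightedHomogeneous_X ℝ (letterWeight W) p)

theorem comp_rBasis [Fintype 𝔏] [DecidableEq 𝔏] (γ : populated 𝔏) (l l' : 𝔏) :
    R.comp l' (rBasis 𝔏 (γ, l)) = if l' = l then tBasis 𝔏 γ else 0 := by
  rw [rBasis_apply]
  change (Pi.single l (tBasis 𝔏 γ) : 𝔏 → T 𝔏) l' = _
  rw [Pi.single_apply]

/-- Each factor `r^{(γ',l)}` removes a letter `l` and inserts the letters of `γ'`, while `D` changes
no letter. The weight `W` stays free because length and the count outside `𝔏'` are both needed. -/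
theorem rhoTilde_weight_eq [Fintype 𝔏] (W : 𝔏 → ℤ) {I : RIndex 𝔏 →₀ ℕ} {β γ : populated 𝔏}
    (h : structConst (rhoTilde 𝔏) (rBasis 𝔏) (tBasis 𝔏) I β γ ≠ 0) :
    Finsupp.weight (letterWeight W) β.1 = Finsupp.weight (letterWeight W) γ.1 +
      I.sum fun i n => n * (Finsupp.weight (letterWeight W) i.1.1 - W i.2) := by
  classical
  refine (rhoTildeNormalOrder 𝔏).weight_eq_of_structConst_ne_zero (rBasis 𝔏) W
    (fun i => Finsupp.weight (letterWeight W) i.1.1 - W i.2) (fun i p => ?_) h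
  rw [rhoTildeNormalOrder_ν]
  rcases p with p | p
  · rw [rightShift_X_inl]
    exact isWeightedHomogeneous_zero _ _ _
  · rw [rightShift_X_inr, shiftDer_X, comp_rBasis]
    split_ifs with hp
    · have e : doubledWeight W (Sum.inr p) + (Finsupp.weight (letterWeight W) i.1.1 - W i.2) =
          Finsupp.weight (letterWeight W) i.1.1 := by
        rw [← hp]
        change W p.1 + _ = _
        abel
      rw [e]
      refine IsWeightedHomogeneous.rename_apply (w := letterWeight W) Sum.inl (fun _ => rfl) ?_
      rw [MvPolynomial.smul_eq_C_mul]
      exact (isWeightedHomogeneous_D_iterate_letterWeight W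
        (isWeightedHomogeneous_incl_tBasis W i.1) p.2).C_mul _
    · rw [map_zero, iterate_map_zero (D 𝔏), smul_zero, map_zero]
      exact isWeightedHomogeneous_zero _ _ _

theorem degree_le_sum_mul {ι : Type*} (I : ι →₀ ℕ) (e : ι → ℤ) (he : ∀ i ∈ I.support, 1 ≤ e i) :
    (I.degree : ℤ) ≤ I.sum fun i n => n * e i := by
  rw [Finsupp.degree_apply, Nat.cast_sum]
  exact Finset.sum_le_sum fun i hi => le_mul_of_one_le_right (by positivity) (he i hi)

theorem le_sum_mul {ι : Type*} (I : ι →₀ ℕ) (e : ι → ℤ) (he : ∀ i ∈ I.support, 0 ≤ e i) {i : ι}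
    (hi : i ∈ I.support) : e i ≤ I.sum fun i n => n * e i := by
  refine le_trans ?_ (Finset.single_le_sum (f := fun i => (I i : ℤ) * e i)
    (fun j hj => mul_nonneg (by positivity) (he j hj)) hi)
  have h : (1 : ℤ) ≤ I i := by
    exact_mod_cast Nat.one_le_iff_ne_zero.2 (Finsupp.mem_support_iff.1 hi)
  exact le_mul_of_one_le_left (he i hi) h

theorem one_le_length (β : populated 𝔏) : 1 ≤ length β.1 := by
  rw [Nat.one_le_iff_ne_zero]
  intro h
  have h0 : β.1 = 0 := (Finsupp.degree_eq_zero_iff β.1).1 h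
  have h1 : bracket β.1 = 1 := β.2
  rw [h0, bracket, map_zero] at h1
  exact zero_ne_one h1

/-- A bound on the length does not by itself bound the index `k`; the constraint `[β] = 1` does,
through `∑ k β(l,k) = |β| - [β] = |β| - 1`. -/
theorem finite_setOf_length_le [Finite 𝔏] (m : ℕ) :
    {β : populated 𝔏 | length β.1 ≤ m}.Finite := by
  classical
  have := Fintype.ofFinite 𝔏
  let A : Finset (𝔏 × ℕ) := Finset.univ ×ˢ Finset.range m
  refine Set.Finite.of_finite_image (f := Subtype.val) ?_ Subtype.val_injective.injOn
  refine ((Finset.range (m + 1)).biUnion fun n => A.finsuppAntidiag n).finite_toSet.subset ?_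
  rintro _ ⟨β, hβ, rfl⟩
  have hβ' : length β.1 ≤ m := hβ
  rw [Finset.mem_coe, Finset.mem_biUnion]
  refine ⟨length β.1, Finset.mem_range.2 (Nat.lt_succ_of_le hβ'), ?_⟩
  have hA : β.1.support ⊆ A := by
    intro p hp
    rw [Finset.mem_product]
    refine ⟨Finset.mem_univ _, Finset.mem_range.2 ?_⟩
    have h1 : bracket β.1 = 1 := β.2
    have h2 : (length β.1 : ℤ) - bracket β.1 = β.1.sum fun p n => n * (p.2 : ℤ) := by
      rw [bracket, Finsupp.weight_apply, length, Finsupp.sum, Finsupp.sum, Finsupp.sum,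
        Nat.cast_sum, ← Finset.sum_sub_distrib]
      refine Finset.sum_congr rfl fun q _ => ?_
      rw [wt, nsmul_eq_mul]
      ring
    have h3 := le_sum_mul β.1 (fun p => (p.2 : ℤ)) (fun _ _ => by positivity) hp
    rw [← h2, h1] at h3
    omega
  rw [Finset.mem_finsuppAntidiag]
  exact ⟨(Finset.sum_subset hA fun i _ hi => by simpa using hi).symm, hA⟩

/-- The populated multi-indices of length at most `m`. -/
def populatedLE (𝔏 : Type*) [Finite 𝔏] (m : ℕ) : Finset (populated 𝔏) :=
  (finite_setOf_length_le m).toFinset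

theorem mem_populatedLE [Finite 𝔏] {m : ℕ} {β : populated 𝔏} :
    β ∈ populatedLE 𝔏 m ↔ length β.1 ≤ m := by
  rw [populatedLE, Set.Finite.mem_toFinset, Set.mem_ofPred_eq]

theorem finite_support_subset_degree_le {ι κ : Type*} (s : Finset ι) (s' : Finset κ) (M : ℕ) :
    {p : (ι →₀ ℕ) × κ | p.1.support ⊆ s ∧ p.1.degree ≤ M ∧ p.2 ∈ s'}.Finite := by
  classical
  refine (((Finset.range (M + 1)).biUnion fun n => s.finsuppAntidiag n) ×ˢ s').finite_toSet.subset
    ?_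
  rintro ⟨I, j⟩ ⟨h1, h2, h3⟩
  simp only [Finset.coe_product, Set.mem_prod, Finset.mem_coe, Finset.mem_biUnion,
    Finset.mem_range, Finset.mem_finsuppAntidiag]
  exact ⟨⟨I.degree, Nat.lt_succ_of_le h2,
    (Finset.sum_subset h1 fun i _ hi => by simpa using hi).symm, h1⟩, h3⟩

theorem rho_bounds [Finite 𝔏] {I : populated 𝔏 →₀ ℕ} {β γ : populated 𝔏}
    (h : structConst rho (tBasis 𝔏) (tBasis 𝔏) I β γ ≠ 0) {m : ℕ} (hm : length β.1 ≤ m) :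
    I.support ⊆ populatedLE 𝔏 m ∧ I.degree ≤ length β.1 ∧ γ ∈ populatedLE 𝔏 m := by
  have hw := rho_weight_eq (fun _ => 1) h
  simp only [weight_one_eq_length] at hw
  have h1 : ∀ i ∈ I.support, (1 : ℤ) ≤ length i.1 := fun i _ => by exact_mod_cast one_le_length i
  have h2 := degree_le_sum_mul I (fun i => (length i.1 : ℤ)) h1
  refine ⟨fun i hi => ?_, by omega, ?_⟩
  · have h3 := le_sum_mul I (fun i => (length i.1 : ℤ)) (fun _ _ => by positivity) hi
    rw [mem_populatedLE]
    omega
  · rw [mem_populatedLE]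
    omega

theorem rho_finitenessProperty [Finite 𝔏] :
    FinitenessProperty rho (tBasis 𝔏) (tBasis 𝔏) Set.univ := fun β =>
  (finite_support_subset_degree_le (populatedLE 𝔏 (length β.1)) (populatedLE 𝔏 (length β.1))
    (length β.1)).subset fun _ hp => rho_bounds hp.2 le_rfl

/-- The length alone does not bound the number of factors, since symbols with `|γ'| = 1` leave it
unchanged. This is why a separate degree bound is required. -/
theorem rhoTilde_length_le [Fintype 𝔏] {I : RIndex 𝔏 →₀ ℕ} {β γ : populated 𝔏}
    (h : structConst (rhoTilde 𝔏) (rBasis 𝔏) (tBasis 𝔏) I β γ ≠ 0) :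
    (∀ i ∈ I.support, length i.1.1 ≤ length β.1 + 1) ∧ length γ.1 ≤ length β.1 := by
  have hw := rhoTilde_weight_eq (fun _ => 1) h
  simp only [weight_one_eq_length] at hw
  have h1 : ∀ i ∈ I.support, (0 : ℤ) ≤ length i.1.1 - 1 := fun i _ => by
    have := one_le_length i.1
    omega
  have h0 : 0 ≤ I.sum fun i n => (n : ℤ) * (length i.1.1 - 1) :=
    Finset.sum_nonneg fun i hi => mul_nonneg (by positivity) (h1 i hi)
  refine ⟨fun i hi => ?_, by omega⟩
  have h3 := le_sum_mul I (fun i => (length i.1.1 : ℤ) - 1) h1 hi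
  omega

/-- The index sets for which the number of factors in the structure constants of `ρ̃` is bounded
in terms of the output. -/
def HasBoundedDegree [Fintype 𝔏] (S : Set (RIndex 𝔏)) : Prop :=
  ∀ β : populated 𝔏, ∃ K : ℕ, ∀ (I : RIndex 𝔏 →₀ ℕ) (γ : populated 𝔏), (I.support : Set _) ⊆ S →
    structConst (rhoTilde 𝔏) (rBasis 𝔏) (tBasis 𝔏) I β γ ≠ 0 → I.degree ≤ K

theorem HasBoundedDegree.finitenessProperty [Fintype 𝔏] {S : Set (RIndex 𝔏)}
    (hS : HasBoundedDegree S) :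
    FinitenessProperty (rhoTilde 𝔏) (rBasis 𝔏) (tBasis 𝔏) S := by
  intro β
  obtain ⟨K, hK⟩ := hS β
  refine (finite_support_subset_degree_le (populatedLE 𝔏 (length β.1 + 1) ×ˢ Finset.univ)
    (populatedLE 𝔏 (length β.1)) K).subset ?_
  rintro ⟨I, γ⟩ ⟨h1, h2⟩
  obtain ⟨h3, h4⟩ := rhoTilde_length_le h2
  exact ⟨fun i hi => Finset.mem_product.2 ⟨mem_populatedLE.2 (h3 i hi), Finset.mem_univ _⟩,
    hK I γ h1 h2, mem_populatedLE.2 h4⟩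

theorem hasBoundedDegree_RIndexGeTwo [Fintype 𝔏] : HasBoundedDegree (RIndexGeTwo 𝔏) := by
  refine fun β => ⟨length β.1, fun I γ hI h => ?_⟩
  have hw := rhoTilde_weight_eq (fun _ => 1) h
  simp only [weight_one_eq_length] at hw
  have h2 := degree_le_sum_mul I (fun i => (length i.1.1 : ℤ) - 1) fun i hi => by
    have : 2 ≤ length i.1.1 := hI hi
    omega
  omega

theorem hasBoundedDegree_RIndexSub [Fintype 𝔏] (𝔏' : Finset 𝔏) :
    HasBoundedDegree (RIndexSub 𝔏') := by
  classical
  refine fun β => ⟨lengthOutside 𝔏' β.1, fun I γ hI h => ?_⟩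
  have hw := rhoTilde_weight_eq (fun l => if l ∈ 𝔏' then 0 else 1) h
  -- In this grading the removed letter lies in `𝔏'` and has weight `0`, while the inserted ones
  -- have total weight at least `1`.
  simp only [weight_indicator_eq_lengthOutside] at hw
  have h2 := degree_le_sum_mul I
    (fun i => (lengthOutside 𝔏' i.1.1 : ℤ) - if i.2 ∈ 𝔏' then 0 else 1) fun i hi => by
      have := hI hi
      rw [if_pos this.1]
      have := this.2
      omega
  omega

/-! ### Recentering and translation on truncations -/

/-- The truncation of a formal series to multi-indices of length at most `m`. -/
def trunc [Finite 𝔏] (m : ℕ) (f : TStar 𝔏) : MvPolynomial (𝔏 × ℕ) ℝ :=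
  T.incl 𝔏 (∑ γ ∈ populatedLE 𝔏 m, f γ • tBasis 𝔏 γ)

theorem trunc_eq_sum [Finite 𝔏] (m : ℕ) (f : TStar 𝔏) :
    trunc m f = ∑ γ ∈ populatedLE 𝔏 m, f γ • monomial γ.1 1 := by
  rw [trunc, map_sum]
  exact Finset.sum_congr rfl fun γ _ => by rw [map_smul, T.incl_tBasis]

theorem trunc_add [Finite 𝔏] (m : ℕ) (f g : TStar 𝔏) :
    trunc m (f + g) = trunc m f + trunc m g := by
  simp only [trunc_eq_sum, Pi.add_apply, add_smul, Finset.sum_add_distrib]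

theorem coeff_trunc [Finite 𝔏] {m : ℕ} (f : TStar 𝔏) {β : populated 𝔏} (hβ : length β.1 ≤ m) :
    coeff β.1 (trunc m f) = f β := by
  classical
  simp only [trunc_eq_sum, coeff_sum, coeff_smul, coeff_monomial, smul_eq_mul, mul_ite, mul_one,
    mul_zero]
  rw [Finset.sum_eq_single β]
  · simp
  · exact fun γ _ hγ => if_neg fun h => hγ (Subtype.ext h)
  · exact fun h => absurd (mem_populatedLE.2 hβ) h

theorem isWeightedHomogeneous_trunc [Finite 𝔏] (m : ℕ) (f : TStar 𝔏) :
    IsWeightedHomogeneous (wt 𝔏) (trunc m f) 1 := T.isWeightedHomogeneous _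

/-- The truncated exponential `∑_{n ≤ m} (1/n!) φ^n D^n ψ`. -/
def recenterPoly (m : ℕ) (φ ψ : MvPolynomial (𝔏 × ℕ) ℝ) : MvPolynomial (𝔏 × ℕ) ℝ :=
  ∑ n ∈ Finset.range (m + 1), (n.factorial : ℝ)⁻¹ • (φ ^ n * (D 𝔏)^[n] ψ)

theorem recenter_apply [Finite 𝔏] {m : ℕ} (f g : TStar 𝔏) {β : populated 𝔏}
    (hβ : length β.1 ≤ m) :
    recenter f g β = coeff β.1 (recenterPoly m (trunc m f) (trunc m g)) := by
  classical
  rw [recenter, (rhoNormalOrder 𝔏).coeff_charAct (tBasis 𝔏) f g β (populatedLE 𝔏 m)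
    (populatedLE 𝔏 m) (m + 1) fun I γ _ h => ?_]
  · rw [map_sum, recenterPoly]
    congr 1
    refine Finset.sum_congr rfl fun n _ => ?_
    rw [rhoNormalOrder_ν_iterate, map_smul, map_mul, diag_inLeft, diag_inRight]
    rfl
  · obtain ⟨h1, h2, h3⟩ := rho_bounds h hβ
    exact ⟨h1, by omega, h3⟩

theorem translate_apply [Fintype 𝔏] {S : Set (RIndex 𝔏)} (hS : HasBoundedDegree S) {c : R 𝔏}
    (hc : (((rBasis 𝔏).repr c).support : Set _) ⊆ S) {m : ℕ} (g : TStar 𝔏) {β : populated 𝔏}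
    (hβ : length β.1 ≤ m) :
    translate c g β = coeff β.1 (shiftHom c (trunc m g)) := by
  classical
  obtain ⟨K, hK⟩ := hS β
  obtain ⟨M₀, hM₀⟩ := exists_sum_rightShift_eq c (trunc m g)
  -- The number of terms must exceed both the degree bound `K` and the threshold beyond which the
  -- exponential series of the truncated argument is constant.
  rw [translate, (rhoTildeNormalOrder 𝔏).coeff_charAct (rBasis 𝔏) _ g β
    ((rBasis 𝔏).repr c).support (populatedLE 𝔏 m) (max M₀ (K + 1)) fun I γ hI h => ?_]
  · have hsum : ∑ i ∈ ((rBasis 𝔏).repr c).support, (rBasis 𝔏).repr c i • rBasis 𝔏 i = c :=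
      (rBasis 𝔏).linearCombination_repr c
    rw [hsum, rhoTildeNormalOrder_ν, ← hM₀ _ (le_max_left _ _)]
    rfl
  · have hI' : I.support ⊆ ((rBasis 𝔏).repr c).support := fun i hi =>
      Finsupp.mem_support_iff.2 (hI i hi)
    exact ⟨hI', lt_max_of_lt_right (Nat.lt_succ_of_le (hK I γ (fun i hi => hc (hI' hi)) h)),
      mem_populatedLE.2 ((rhoTilde_length_le h).2.trans hβ)⟩

/-! ### Chen's relation -/

/-- Equality up to length `m` is expressed as congruence modulo a power of the ideal of the
variables, which products, `D` and substitutions respect. Homogeneity reduces it to populated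
coefficients. -/
theorem sub_mem_pow_idealOfVars {m : ℕ} {φ ψ : MvPolynomial (𝔏 × ℕ) ℝ}
    (hφ : IsWeightedHomogeneous (wt 𝔏) φ 1) (hψ : IsWeightedHomogeneous (wt 𝔏) ψ 1)
    (h : ∀ β : populated 𝔏, length β.1 ≤ m → coeff β.1 φ = coeff β.1 ψ) :
    φ - ψ ∈ idealOfVars (𝔏 × ℕ) ℝ ^ (m + 1) := by
  rw [mem_pow_idealOfVars_iff']
  intro β hβ
  by_cases hpop : β ∈ populated 𝔏
  · rw [coeff_sub, sub_eq_zero]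
    exact h ⟨β, hpop⟩ (Nat.le_of_lt_succ hβ)
  · exact (hφ.sub hψ).coeff_eq_zero β hpop

theorem coeff_eq_of_sub_mem {m : ℕ} {φ ψ : MvPolynomial (𝔏 × ℕ) ℝ}
    (h : φ - ψ ∈ idealOfVars (𝔏 × ℕ) ℝ ^ (m + 1)) {β : 𝔏 × ℕ →₀ ℕ} (hβ : length β ≤ m) :
    coeff β φ = coeff β ψ := by
  rw [← sub_eq_zero, ← coeff_sub]
  exact (mem_pow_idealOfVars_iff' _ _).1 h β (Nat.lt_succ_of_le hβ)

theorem derivation_mem_pow_of_mem_pow {A : Type*} [CommRing A] [Algebra ℝ A]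
    (d : Derivation ℝ A A) {J : Ideal A} (hd : ∀ a ∈ J, d a ∈ J) (n : ℕ) :
    ∀ a ∈ J ^ n, d a ∈ J ^ n := by
  induction n with
  | zero => simp
  | succ n ih =>
    intro a ha
    rw [pow_succ] at ha ⊢
    refine Submodule.mul_induction_on ha (fun x hx y hy => ?_) fun x y hx hy => ?_
    · rw [Derivation.leibniz, smul_eq_mul, smul_eq_mul, mul_comm y]
      exact add_mem (Ideal.mul_mem_mul hx (hd y hy)) (Ideal.mul_mem_mul (ih x hx) hy)
    · rw [map_add]
      exact add_mem hx hy

theorem D_mem_idealOfVars {φ : MvPolynomial (𝔏 × ℕ) ℝ} (hφ : φ ∈ idealOfVars (𝔏 × ℕ) ℝ) :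
    D 𝔏 φ ∈ idealOfVars (𝔏 × ℕ) ℝ := by
  rw [idealOfVars] at hφ ⊢
  refine Submodule.span_induction ?_ ?_ ?_ ?_ hφ
  · rintro _ ⟨p, rfl⟩
    rw [D_X, MvPolynomial.smul_eq_C_mul]
    exact Ideal.mul_mem_left _ _ (Ideal.subset_span ⟨_, rfl⟩)
  · simp
  · intro x y _ _ hx hy
    rw [map_add]
    exact add_mem hx hy
  · intro a x hx' hx
    rw [smul_eq_mul, Derivation.leibniz, smul_eq_mul, smul_eq_mul]
    exact add_mem (Ideal.mul_mem_left _ _ hx) (Ideal.mul_mem_right _ _ hx')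

theorem D_iterate_mem_pow_idealOfVars {m : ℕ} (n : ℕ) {φ : MvPolynomial (𝔏 × ℕ) ℝ}
    (hφ : φ ∈ idealOfVars (𝔏 × ℕ) ℝ ^ m) : (D 𝔏)^[n] φ ∈ idealOfVars (𝔏 × ℕ) ℝ ^ m := by
  induction n with
  | zero => exact hφ
  | succ n ih =>
    rw [Function.iterate_succ_apply']
    exact derivation_mem_pow_of_mem_pow (D 𝔏) (fun _ => D_mem_idealOfVars) m _ ih

theorem incl_mem_idealOfVars (x : T 𝔏) : T.incl 𝔏 x ∈ idealOfVars (𝔏 × ℕ) ℝ := by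
  rw [← pow_one (idealOfVars (𝔏 × ℕ) ℝ), mem_pow_idealOfVars_iff']
  intro β hβ
  refine x.isWeightedHomogeneous.coeff_eq_zero β fun h => ?_
  have := one_le_length ⟨β, h⟩
  exact absurd hβ (not_lt.2 this)

/-- Elements of `T` have no constant term, because `[0] = 0 ≠ 1`, and `D` preserves this. So the
substitution never lowers the order of vanishing at the origin. -/
theorem shiftHom_mem_idealOfVars (c : R 𝔏) {φ : MvPolynomial (𝔏 × ℕ) ℝ}
    (hφ : φ ∈ idealOfVars (𝔏 × ℕ) ℝ) : shiftHom c φ ∈ idealOfVars (𝔏 × ℕ) ℝ := by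
  have h : idealOfVars (𝔏 × ℕ) ℝ ≤ (idealOfVars (𝔏 × ℕ) ℝ).comap (shiftHom c) := by
    conv_lhs => rw [idealOfVars]
    rw [Ideal.span_le]
    rintro _ ⟨p, rfl⟩
    rw [SetLike.mem_coe, Ideal.mem_comap, shiftHom_X, shiftDer_X, MvPolynomial.smul_eq_C_mul]
    refine add_mem (Ideal.subset_span ⟨p, rfl⟩) (Ideal.mul_mem_left _ _ ?_)
    have h1 := D_iterate_mem_pow_idealOfVars (m := 1) p.2
      (by rw [pow_one]; exact incl_mem_idealOfVars (R.comp p.1 c))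
    rwa [pow_one] at h1
  exact h hφ

theorem shiftHom_mem_pow_idealOfVars (c : R 𝔏) {m : ℕ} {φ : MvPolynomial (𝔏 × ℕ) ℝ}
    (hφ : φ ∈ idealOfVars (𝔏 × ℕ) ℝ ^ m) : shiftHom c φ ∈ idealOfVars (𝔏 × ℕ) ℝ ^ m := by
  have h1 := Ideal.mem_map_of_mem (shiftHom c) hφ
  rw [Ideal.map_pow] at h1
  exact Ideal.pow_right_mono (Ideal.map_le_iff_le_comap.2 fun _ => shiftHom_mem_idealOfVars c) m h1

theorem recenterPoly_sub_mem {m k : ℕ} {φ φ' ψ ψ' : MvPolynomial (𝔏 × ℕ) ℝ}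
    (hφ : φ - φ' ∈ idealOfVars (𝔏 × ℕ) ℝ ^ k) (hψ : ψ - ψ' ∈ idealOfVars (𝔏 × ℕ) ℝ ^ k) :
    recenterPoly m φ ψ - recenterPoly m φ' ψ' ∈ idealOfVars (𝔏 × ℕ) ℝ ^ k := by
  rw [recenterPoly, recenterPoly, ← Finset.sum_sub_distrib]
  refine sum_mem fun n _ => ?_
  rw [← smul_sub, MvPolynomial.smul_eq_C_mul]
  refine Ideal.mul_mem_left _ _ (Ideal.mul_sub_mul_mem _ ?_ ?_)
  · exact Ideal.mem_of_dvd _ (sub_dvd_pow_sub_pow φ φ' n) hφ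
  · rw [← iterate_map_sub (D 𝔏)]
    exact D_iterate_mem_pow_idealOfVars n hψ

theorem shiftHom_recenterPoly (c : R 𝔏) (m : ℕ) (φ ψ : MvPolynomial (𝔏 × ℕ) ℝ) :
    shiftHom c (recenterPoly m φ ψ) = recenterPoly m (shiftHom c φ) (shiftHom c ψ) := by
  simp only [recenterPoly, map_sum, map_smul, map_mul, map_pow, shiftHom_D_iterate]

theorem isWeightedHomogeneous_recenterPoly (m : ℕ) {φ ψ : MvPolynomial (𝔏 × ℕ) ℝ}
    (hφ : IsWeightedHomogeneous (wt 𝔏) φ 1) (hψ : IsWeightedHomogeneous (wt 𝔏) ψ 1) :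
    IsWeightedHomogeneous (wt 𝔏) (recenterPoly m φ ψ) 1 := by
  refine IsWeightedHomogeneous.sum _ _ _ fun n _ => ?_
  rw [MvPolynomial.smul_eq_C_mul]
  have h := ((hφ.pow n).mul (isWeightedHomogeneous_D_iterate hψ n)).C_mul ((n.factorial : ℝ)⁻¹)
  -- The factor `φ^n` raises the weight by `n` and `D^n` lowers it by `n`.
  have e : n • (1 : ℤ) + (1 - n) = 1 := by simp
  rwa [e] at h

theorem isWeightedHomogeneous_shiftHom (c : R 𝔏) {φ : MvPolynomial (𝔏 × ℕ) ℝ} {n : ℤ}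
    (hφ : IsWeightedHomogeneous (wt 𝔏) φ n) : IsWeightedHomogeneous (wt 𝔏) (shiftHom c φ) n :=
  hφ.algHom_apply (shiftHom c) fun p => by
    rw [shiftHom_X]
    have h := isWeightedHomogeneous_X ℝ (wt 𝔏) p
    exact h.add (isWeightedHomogeneous_shiftDer c h)

section Translate

variable [Fintype 𝔏] {S : Set (RIndex 𝔏)} (hS : HasBoundedDegree S) {c : R 𝔏}
  (hc : (((rBasis 𝔏).repr c).support : Set _) ⊆ S)

include hS hc

theorem translate_add (f g : TStar 𝔏) : translate c (f + g) = translate c f + translate c g := by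
  funext β
  rw [Pi.add_apply, translate_apply hS hc _ le_rfl, translate_apply hS hc _ le_rfl,
    translate_apply hS hc _ le_rfl, trunc_add, map_add, coeff_add]

/-- Translations are morphisms for the recentering. -/
theorem translate_recenter (f g : TStar 𝔏) :
    translate c (recenter f g) = recenter (translate c f) (translate c g) := by
  funext β
  -- Translation and truncation commute only up to terms longer than `β`; these do not affect the
  -- coefficient at `β`.
  have hT : ∀ h : TStar 𝔏, shiftHom c (trunc (length β.1) h) -
      trunc (length β.1) (translate c h) ∈ idealOfVars (𝔏 × ℕ) ℝ ^ (length β.1 + 1) := fun h =>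
    sub_mem_pow_idealOfVars (isWeightedHomogeneous_shiftHom c (isWeightedHomogeneous_trunc _ _))
      (isWeightedHomogeneous_trunc _ _) fun γ hγ => by
        rw [coeff_trunc _ hγ, translate_apply hS hc _ hγ]
  have hR : trunc (length β.1) (recenter f g) -
      recenterPoly (length β.1) (trunc (length β.1) f) (trunc (length β.1) g) ∈
        idealOfVars (𝔏 × ℕ) ℝ ^ (length β.1 + 1) :=
    sub_mem_pow_idealOfVars (isWeightedHomogeneous_trunc _ _) (isWeightedHomogeneous_recenterPoly _
      (isWeightedHomogeneous_trunc _ _) (isWeightedHomogeneous_trunc _ _)) fun γ hγ => by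
        rw [coeff_trunc _ hγ, recenter_apply _ _ hγ]
  have hR' := shiftHom_mem_pow_idealOfVars c hR
  rw [map_sub, shiftHom_recenterPoly] at hR'
  rw [translate_apply hS hc _ le_rfl, recenter_apply _ _ le_rfl, coeff_eq_of_sub_mem hR' le_rfl]
  exact coeff_eq_of_sub_mem (recenterPoly_sub_mem (hT f) (hT g)) le_rfl

/-! ### Hölder bounds -/

theorem translate_apply_eq_sum (g : TStar 𝔏) (β : populated 𝔏) :
    translate c g β = ∑ γ ∈ populatedLE 𝔏 (length β.1),
      g γ * coeff β.1 (shiftHom c (monomial γ.1 1)) := by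
  rw [translate_apply hS hc _ le_rfl, trunc_eq_sum, map_sum, coeff_sum]
  exact Finset.sum_congr rfl fun γ _ => by rw [map_smul, coeff_smul, smul_eq_mul]

/-- The exponents `d` cover both regularity assumptions: `d γ = α |γ|` and `d γ = |γ|_{𝔏'}`. As `|t
- s| ≤ 1`, the inequality `α' |β| ≤ d γ` is only needed when `z^γ` contributes to the coefficient
`β`. -/
theorem isRoughPath_translate {α α' : ℝ} {X : unitInterval → unitInterval → TStar 𝔏}
    (hX : IsRoughPath α X) (h0 : 0 < α') (h1 : α' < 1) (d : populated 𝔏 → ℝ)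
    (hd : ∀ β : populated 𝔏, ∃ C : ℝ, ∀ s t : unitInterval, s < t →
      |X s t β| / |(t : ℝ) - s| ^ d β ≤ C)
    (hle : ∀ β γ : populated 𝔏, coeff β.1 (shiftHom c (monomial γ.1 1)) ≠ 0 →
      α' * length β.1 ≤ d γ) :
    IsRoughPath α' fun s t => translate c (X s t) where
  pos := h0
  lt_one := h1
  chen s u t hsu hut := by
    rw [hX.chen s u t hsu hut, translate_add hS hc, translate_recenter hS hc]
  holder β := by
    choose C hC using hd
    refine ⟨∑ γ ∈ populatedLE 𝔏 (length β.1),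
      C γ * |coeff β.1 (shiftHom c (monomial γ.1 1))|, fun s t hst => ?_⟩
    have hst' : (s : ℝ) < t := hst
    have ht := t.2.2
    have hs := s.2.1
    have hpos : 0 < |(t : ℝ) - s| := abs_pos.2 (by linarith)
    have hle1 : |(t : ℝ) - s| ≤ 1 := by
      rw [abs_of_pos (by linarith)]
      linarith
    rw [div_le_iff₀ (Real.rpow_pos_of_pos hpos _), translate_apply_eq_sum hS hc, Finset.sum_mul]
    refine (Finset.abs_sum_le_sum_abs _ _).trans (Finset.sum_le_sum fun γ _ => ?_)
    rw [abs_mul]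
    by_cases hz : coeff β.1 (shiftHom c (monomial γ.1 1)) = 0
    · rw [hz, abs_zero, mul_zero, mul_zero, zero_mul]
    · have hb := hC γ s t hst
      have hC0 : 0 ≤ C γ := le_trans (by positivity) hb
      rw [div_le_iff₀ (Real.rpow_pos_of_pos hpos _)] at hb
      have hb' : |X s t γ| ≤ C γ * |(t : ℝ) - s| ^ (α' * length β.1) :=
        hb.trans (mul_le_mul_of_nonneg_left
          (Real.rpow_le_rpow_of_exponent_ge hpos hle1 (hle β γ hz)) hC0)
      calc |X s t γ| * |coeff β.1 (shiftHom c (monomial γ.1 1))|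
          ≤ C γ * |(t : ℝ) - s| ^ (α' * length β.1) *
            |coeff β.1 (shiftHom c (monomial γ.1 1))| :=
            mul_le_mul_of_nonneg_right hb' (abs_nonneg _)
        _ = _ := by ring

end Translate

/-! ### Growth of the length under translation and the resulting Hölder exponents. -/

theorem totalDegree_D_le (φ : MvPolynomial (𝔏 × ℕ) ℝ) : (D 𝔏 φ).totalDegree ≤ φ.totalDegree := by
  conv_lhs => rw [φ.as_sum, map_sum]
  refine (totalDegree_finsetSum _ _).trans (Finset.sup_le fun γ hγ => ?_)
  refine (Finset.sup_le fun β hβ => ?_ : (D 𝔏 (monomial γ (coeff γ φ))).totalDegree ≤ length γ).trans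
    (le_totalDegree hγ)
  have h := isWeightedHomogeneous_D_letterWeight (fun _ : 𝔏 => 1)
    (isWeightedHomogeneous_monomial _ γ (coeff γ φ) (weight_one_eq_length γ))
    (mem_support_iff.1 hβ)
  rw [weight_one_eq_length] at h
  exact (Int.ofNat.inj h).le

theorem totalDegree_D_iterate_le (n : ℕ) (φ : MvPolynomial (𝔏 × ℕ) ℝ) :
    ((D 𝔏)^[n] φ).totalDegree ≤ φ.totalDegree := by
  induction n with
  | zero => exact le_rfl
  | succ n ih =>
    rw [Function.iterate_succ_apply']
    exact (totalDegree_D_le _).trans ih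

/-- A translation increases the length at most by the length of its coefficients. -/
theorem length_le_of_coeff_shiftHom_ne_zero {c : R 𝔏} {u : 𝔏 → ℕ} (hu : ∀ l, 1 ≤ u l)
    (hc : ∀ l, (T.incl 𝔏 (R.comp l c)).totalDegree ≤ u l) {β γ : 𝔏 × ℕ →₀ ℕ}
    (h : coeff β (shiftHom c (monomial γ 1)) ≠ 0) :
    length β ≤ γ.sum fun p n => n * u p.1 := by
  refine (le_totalDegree (mem_support_iff.2 h)).trans ?_
  rw [shiftHom, aeval_monomial, map_one, one_mul]
  refine (totalDegree_finsetProd _ _).trans (Finset.sum_le_sum fun p _ => ?_)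
  refine (totalDegree_pow _ _).trans (Nat.mul_le_mul_left _ ?_)
  refine (totalDegree_add _ _).trans (max_le ?_ ?_)
  · rw [totalDegree_X]
    exact hu p.1
  · rw [shiftDer_X]
    exact (totalDegree_smul_le _ _).trans ((totalDegree_D_iterate_le _ _).trans (hc p.1))

theorem totalDegree_comp_le [Fintype 𝔏] {c : R 𝔏} {l : 𝔏} {N : ℕ}
    (h : ∀ γ, (γ, l) ∈ ((rBasis 𝔏).repr c).support → length γ.1 ≤ N) :
    (T.incl 𝔏 (R.comp l c)).totalDegree ≤ N := by
  refine Finset.sup_le fun γ hγ => ?_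
  rw [mem_support_iff] at hγ
  have hpop : γ ∈ populated 𝔏 := (R.comp l c).isWeightedHomogeneous hγ
  exact h ⟨γ, hpop⟩ (Finsupp.mem_support_iff.2 hγ)

theorem mem_of_mem_RTrunc [Fintype 𝔏] {S : Set (RIndex 𝔏)} {N : ℕ} {c : R 𝔏}
    (hc : c ∈ RTrunc S N) {i : RIndex 𝔏} (hi : i ∈ ((rBasis 𝔏).repr c).support) :
    i ∈ S ∧ length i.1.1 ≤ N :=
  ((rBasis 𝔏).mem_span_image.1 hc) hi

/-- Each letter is replaced by at most `N` letters, so `|β| ≤ N |γ|` and `(α/N) |β| ≤ α |γ|`. The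
set `S` matters only for finiteness, hence parts (i) and (ii) are treated at once. -/
theorem isRoughPath_translate_of_mem_RTrunc [Fintype 𝔏] {S : Set (RIndex 𝔏)}
    (hS : HasBoundedDegree S) {N : ℕ} (hN : 1 ≤ N) {c : R 𝔏} (hc : c ∈ RTrunc S N) {α : ℝ}
    {X : unitInterval → unitInterval → TStar 𝔏} (hX : IsRoughPath α X) :
    IsRoughPath (α / N) fun s t => translate c (X s t) := by
  have hN' : (1 : ℝ) ≤ N := by exact_mod_cast hN
  have hα := hX.pos
  refine isRoughPath_translate hS (fun i hi => (mem_of_mem_RTrunc hc hi).1) hX (by positivity)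
    ((div_le_self hα.le hN').trans_lt hX.lt_one) _ hX.holder fun β γ h => ?_
  have hlen := length_le_of_coeff_shiftHom_ne_zero (u := fun _ => N) (fun _ => hN)
    (fun l => totalDegree_comp_le fun γ hγ => (mem_of_mem_RTrunc hc hγ).2) h
  rw [← Finsupp.sum_mul] at hlen
  have hlen' : (length β.1 : ℝ) ≤ length γ.1 * N := by exact_mod_cast hlen
  rw [div_mul_eq_mul_div, div_le_iff₀ (by positivity), mul_assoc]
  exact mul_le_mul_of_nonneg_left hlen' hα.le

theorem isRoughPath_translate_of_subDegree [Fintype 𝔏] (𝔏' : Finset 𝔏) (h𝔏' : 𝔏'.Nonempty)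
    {N : ℕ} (hN : 1 ≤ N) {c : R 𝔏} (hc : c ∈ RTrunc (RIndexSub 𝔏') N) {α : ℝ}
    {X : unitInterval → unitInterval → TStar 𝔏} (hX : IsRoughPath α X) (a : 𝔏 → ℝ)
    (ha : ∀ l ∈ 𝔏', α ≤ a l)
    (hd : ∀ β : populated 𝔏, ∃ C : ℝ, ∀ s t : unitInterval, s < t →
      |X s t β| / |(t : ℝ) - s| ^ subDegree 𝔏' α a β.1 ≤ C) :
    IsRoughPath (min α (𝔏'.inf' h𝔏' a / N)) fun s t => translate c (X s t) := by
  classical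
  have hN' : (0 : ℝ) < N := by exact_mod_cast hN
  have hα := hX.pos
  have hinf : 0 < 𝔏'.inf' h𝔏' a := (Finset.lt_inf'_iff _).2 fun l hl => hα.trans_le (ha l hl)
  have hpos : 0 < min α (𝔏'.inf' h𝔏' a / N) := lt_min hα (by positivity)
  refine isRoughPath_translate (hasBoundedDegree_RIndexSub 𝔏')
    (fun i hi => (mem_of_mem_RTrunc hc hi).1) hX hpos
    ((min_le_left _ _).trans_lt hX.lt_one) _ hd fun β γ h => ?_
  -- For `l ∉ 𝔏'` the component `c_l` vanishes, so such letters are left unchanged and count only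
  -- once.
  have hlen := length_le_of_coeff_shiftHom_ne_zero (u := fun l => if l ∈ 𝔏' then N else 1)
    (fun l => by split_ifs <;> omega) (fun l => totalDegree_comp_le fun γ hγ => by
      obtain ⟨h1, h2⟩ := mem_of_mem_RTrunc hc hγ
      rwa [if_pos h1.1]) h
  have hlen' : (length β.1 : ℝ) ≤ ∑ p ∈ γ.1.support,
      (γ.1 p : ℝ) * ((if p.1 ∈ 𝔏' then N else 1 : ℕ) : ℝ) := by exact_mod_cast hlen
  refine (mul_le_mul_of_nonneg_left hlen' hpos.le).trans ?_
  rw [Finset.mul_sum, subDegree, Finsupp.sum]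
  -- The comparison is made letter by letter: a letter in `𝔏'` costs at most `N (α_min / N) ≤ α_l`,
  -- any other at most `α`.
  refine Finset.sum_le_sum fun p _ => ?_
  rw [mul_comm (γ.1 p : ℝ), ← mul_assoc]
  refine mul_le_mul_of_nonneg_right ?_ (by positivity)
  by_cases hp : p.1 ∈ 𝔏'
  · simp only [if_pos hp]
    rw [← le_div_iff₀ hN']
    exact (min_le_right _ _).trans
      (div_le_div_of_nonneg_right (Finset.inf'_le a hp) hN'.le)
  · simp only [if_neg hp, Nat.cast_one, mul_one]
    exact min_le_left _ _

end MultiIndex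

end

theorem mainTheorem1 {𝔏 : Type*} [Fintype 𝔏] (α : ℝ)
    (X : unitInterval → unitInterval → MultiIndex.TStar 𝔏)
    (hX : MultiIndex.IsRoughPath α X) (N : ℕ) (hN : 1 ≤ N) :
    -- all sums in the definition of `ρ_D(exp_D f)` are finite
    PreLie.FinitenessProperty PreLie.rho (MultiIndex.tBasis 𝔏) (MultiIndex.tBasis 𝔏) Set.univ ∧
    -- translations by elements with multi-indices of length between `2` and `N`
    (PreLie.FinitenessProperty (MultiIndex.rhoTilde 𝔏) (MultiIndex.rBasis 𝔏)
        (MultiIndex.tBasis 𝔏) (MultiIndex.RIndexGeTwo 𝔏) ∧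
      ∀ c ∈ MultiIndex.RTrunc (MultiIndex.RIndexGeTwo 𝔏) N,
        MultiIndex.IsRoughPath (α / N) fun s t => MultiIndex.translate c (X s t)) ∧
    -- translations of the components in `𝔏'`, without and with higher regularity in `𝔏'`
    ∀ (𝔏' : Finset 𝔏) (h𝔏' : 𝔏'.Nonempty),
      PreLie.FinitenessProperty (MultiIndex.rhoTilde 𝔏) (MultiIndex.rBasis 𝔏)
          (MultiIndex.tBasis 𝔏) (MultiIndex.RIndexSub 𝔏') ∧
      ∀ c ∈ MultiIndex.RTrunc (MultiIndex.RIndexSub 𝔏') N,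
        MultiIndex.IsRoughPath (α / N) (fun s t => MultiIndex.translate c (X s t)) ∧
        ∀ a : 𝔏 → ℝ, (∀ l ∈ 𝔏', α ≤ a l) →
          (∀ β : MultiIndex.populated 𝔏, ∃ C : ℝ, ∀ s t : unitInterval, s < t →
            |X s t β| / |(t : ℝ) - s| ^ MultiIndex.subDegree 𝔏' α a β.1 ≤ C) →
          MultiIndex.IsRoughPath (min α (𝔏'.inf' h𝔏' a / N))
            fun s t => MultiIndex.translate c (X s t) := by
  refine ⟨MultiIndex.rho_finitenessProperty,
    ⟨MultiIndex.hasBoundedDegree_RIndexGeTwo.finitenessProperty, fun c hc =>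
      MultiIndex.isRoughPath_translate_of_mem_RTrunc MultiIndex.hasBoundedDegree_RIndexGeTwo hN hc
        hX⟩,
    fun 𝔏' h𝔏' =>
      ⟨(MultiIndex.hasBoundedDegree_RIndexSub 𝔏').finitenessProperty, fun c hc =>
        ⟨MultiIndex.isRoughPath_translate_of_mem_RTrunc
            (MultiIndex.hasBoundedDegree_RIndexSub 𝔏') hN hc hX,
          fun a ha hd =>
            MultiIndex.isRoughPath_translate_of_subDegree 𝔏' h𝔏' hN hc hX a ha hd⟩⟩⟩
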